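/- **Setting.** All maps are on oriented surfaces. A toroidal unicellular map is a map on the torus with exactly one face. A cycle is a closed walk (of length at least $1$, loops being cycles of length $1$) with no repeated vertex and no repeated edge. A vertex is *special* if it is on all cycles of the map; a toroidal unicellular map has either one special vertex (square case) or two (hexagonal case). A *stem* is a dangling half-edge attached to a vertex. Let $n\ge 1$ and let $T$ be a toroidal unicellular map with $n$ vertices, $n+1$ edges and $2n-1$ stems, rooted at an angle $a_0$ of a vertex $v_0$ (the root vertex), such that: each vertex other than $v_0$ carries exactly $2$ stems if it is not special, $1$ stem if it is special in the hexagonal case, and $0$ stems if it is special in the square case; $v_0$ carries exactly one more stem than this rule prescribes; and the half-edge just after $a_0$ in counterclockwise order around $v_0$ is a stem (the root stem). "Clockwise around the unique face" is the direction of walking along its border with the face on the right; it passes the angles at the two sides of a stem in counterclockwise order around the vertex of the stem. *Balanced.* Orient all stems as outgoing, and orient each edge opposite to the direction in which it is first traversed when walking clockwise around the unique face from $a_0$. For a cycle $C$ with a traversal direction let $\gamma(C)$ be the number of outgoing edges and stems at the vertices of $C$ incident to its right side minus the number of those incident to its left side. Assume that $\gamma(C)=0$ for every cycle $C$. *Closure.*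 An admissible triple $(e_1,e_2,s)$ consists of edges $e_1=(u,v)$, $e_2=(v,w)$ and a stem $s$ at $w$ that are consecutive in counterclockwise order along the border of a face. Closing it means attaching the dangling end of $s$ to the angle at $u$ before $e_1$, so that $s$ becomes an edge from $w$ to $u$ with a triangular face $(u,v,w)$ on its left; if that angle is the root angle, the root angle is kept on the right side of the end of $s$. A complete closure of $T$ is obtained by successively closing admissible triples, in any order, until no stem is left. Assume that $T$ is *safe*: whenever a triple is closed in this procedure, the root angle stays on the right side of the stem, i.e. is not one of the angles between the stem and its attachment point that are enclosed in the new triangle. Let $G=\Phi(T)$ be the map obtained by a complete closure of $T$; it has the same vertex set $V$ as $T$, and $d_G$ denotes its graph distance. *Labels.* Let $\ell=4n+1$ be the number of angles of $T$. Add a dangling root half-edge (not a stem) in the angle $a_0$, and let $a_0,a_1,\dots,a_\ell$ be the successive angles in clockwise order around the unique face, where $a_0$ is now the angle just after the root half-edge in counterclockwise order around $v_0$ and $a_\ell$ is the angle just before it. Put $\lambda(a_0)=3$, and $\lambda(a_{i+1})=\lambda(a_i)+1$ if $a_i$ and $a_{i+1}$ are consecutive around a stem, $\lambda(a_{i+1})=\lambda(a_i)-1$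 if they are consecutive along an edge. For $v\in V$ let $m(v)$ be the minimum of $\lambda(a_i)$ and $b(v)$ the minimum of $i$ over all $0\le i\le \ell$ with $a_i$ incident to $v$. For $u,v\in V$ let $$\overline m(u,v)=\min\{\lambda(a_k):\ \min(b(u),b(v))\le k\le \max(b(u),b(v))\}.$$ **Statement.** A complete closure of $T$ exists, and for every complete closure $G$ of $T$, the graph $G$ is connected (so that $d_G$ is finite) and: 1. for all $v\in V$, $\ \dfrac{m(v)}{7}\le d_G(v_0,v)\le m(v)$; 2. for all $u,v\in V$, $\ d_G(u,v)\le m(u)+m(v)-2\,\overline m(u,v)+14$. -/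

import Mathlib

noncomputable section

/-- A rooted oriented map with stems, as a rotation system. `D` is the set of darts (half-edges),
`V` the set of vertices, `vert d` the vertex to which the dart `d` is attached.
`rot d` is the dart following `d` in counterclockwise order around its vertex; the vertices are
exactly the orbits of `rot`. `flip d` is the other half of the edge carrying `d`, and a fixed point
of `flip` is a stem, i.e. a dangling half-edge.

A dart `d` also names an angle, namely the one just before `d` in counterclockwise order around
`vert d` (between `rot⁻¹ d` and `d`). The root angle is the angle named by `root`. -/
structure StemMap (V : Type*) (D : Type*) where
  vert : D → V
  rot : Equiv.Perm D
  flip : Equiv.Perm D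
  root : D
  flip_flip : ∀ d, flip (flip d) = d
  vert_surjective : Function.Surjective vert
  vert_eq_iff : ∀ d d', vert d = vert d' ↔ rot.SameCycle d d'

namespace StemMap

variable {V : Type*} {D : Type*}

/-- The dart `d` is a stem. -/
def IsStem (T : StemMap V D) (d : D) : Prop := T.flip d = d

/-- One step clockwise around a face, on angles: from the angle just before `d`, pass `d`
(walk along its edge, or around it if it is a stem) to the next angle of the same face.
The faces are the orbits of `face`. -/
def face (T : StemMap V D) : Equiv.Perm D := T.rot * T.flip

/-- The root vertex. -/
def rootVertex (T : StemMap V D) : V := T.vert T.root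

/-! ### Cycles and special vertices -/

/-- `c 0, …, c k` are the successive darts of a cycle of length `k + 1` with a traversal
direction: the cycle leaves the vertex of `c i` through `c i` and arrives at the vertex of
`c (i + 1)` through `flip (c i)`, indices being cyclic. No vertex is repeated, and no dart occurs
together with its other half (so no stem occurs and no edge is used twice). -/
structure IsCycle (T : StemMap V D) {k : ℕ} (c : Fin (k + 1) → D) : Prop where
  vert_flip : ∀ i, T.vert (T.flip (c i)) = T.vert (c (i + 1))
  injective : Function.Injective fun i => T.vert (c i)
  flip_ne : ∀ i j, T.flip (c i) ≠ c j

/-- A special vertex is one that is on all cycles of the map. -/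
def IsSpecial (T : StemMap V D) (v : V) : Prop :=
  ∀ (k : ℕ) (c : Fin (k + 1) → D), T.IsCycle c → ∃ i, T.vert (c i) = v

/-- Number of stems attached to `v`. -/
def stemCount (T : StemMap V D) (v : V) : ℕ := {d | T.IsStem d ∧ T.vert d = v}.ncard

open Classical in
/-- Rooted toroidal unicellular maps with `n` vertices, `n + 1` edges and `2n - 1` stems (one face,
so by Euler's formula the surface is a torus), with the prescribed numbers of stems at the vertices.
The map is square if it has one special vertex and hexagonal if it has two. The root angle is just
before the root stem `root` in counterclockwise order. -/
structure IsRootedUnicellular (T : StemMap V D) (n : ℕ) : Prop where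
  card_vertex : Nat.card V = n
  card_edge : {d | ¬ T.IsStem d}.ncard = 2 * (n + 1)
  card_stem : {d | T.IsStem d}.ncard + 1 = 2 * n
  unicellular : ∀ d d', T.face.SameCycle d d'
  root_isStem : T.IsStem T.root
  stemCount_normal : ∀ v, ¬ T.IsSpecial v →
    T.stemCount v = 2 + if v = T.rootVertex then 1 else 0
  stemCount_hexagonal : {v | T.IsSpecial v}.ncard = 2 → ∀ v, T.IsSpecial v →
    T.stemCount v = 1 + if v = T.rootVertex then 1 else 0
  stemCount_square : {v | T.IsSpecial v}.ncard = 1 → ∀ v, T.IsSpecial v →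
    T.stemCount v = 0 + if v = T.rootVertex then 1 else 0

/-! ### Canonical orientation and balanced property -/

/-- The angles `a_0, a_1, …` met from the root angle while walking clockwise around its face. -/
def angle (T : StemMap V D) (i : ℕ) : D := (T.face ^ i) T.root

/-- The dart `d` is outgoing at its vertex in the canonical orientation: all stems are outgoing,
and an edge is oriented against the direction in which it is first walked along in the clockwise
walk around the face from the root angle; thus `d` is outgoing when it comes after `flip d`. -/
def IsOut (T : StemMap V D) (d : D) : Prop :=
  T.IsStem d ∨ ∃ i j, i < j ∧ j < Nat.card D ∧ T.angle i = T.flip d ∧ T.angle j = d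

/-- The dart `x` is strictly between `a` and `b` in counterclockwise order from `a` to `b`. -/
def Between (T : StemMap V D) (a b x : D) : Prop :=
  ∃ i : ℕ, 0 < i ∧ (T.rot ^ i) a = x ∧ ∀ j : ℕ, 0 < j → j ≤ i → (T.rot ^ j) a ≠ b

/-- Number of outgoing darts strictly between `a` and `b` in counterclockwise order. -/
def outBetween (T : StemMap V D) (a b : D) : ℕ := {x | T.Between a b x ∧ T.IsOut x}.ncard

/-- `γ` of a cycle with a traversal direction: number of outgoing edges and stems incident to its
right side minus number of those incident to its left side. At the vertex of `c (i + 1)` the cycle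
arrives through `flip (c i)` and leaves through `c (i + 1)`; its right side is between the former
and the latter in counterclockwise order. -/
def gamma (T : StemMap V D) {k : ℕ} (c : Fin (k + 1) → D) : ℤ :=
  ∑ i, ((T.outBetween (T.flip (c i)) (c (i + 1)) : ℤ)
    - T.outBetween (c (i + 1)) (T.flip (c i)))

/-- All cycles have `γ = 0` (in a unicellular map every cycle is non-contractible). -/
def IsBalanced (T : StemMap V D) : Prop :=
  ∀ (k : ℕ) (c : Fin (k + 1) → D), T.IsCycle c → T.gamma c = 0

/-! ### Closure procedure -/

/-- Inserting the new element `none` just before `some c` in a permutation. -/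
def insertBefore (σ : Equiv.Perm D) (c : D) : Equiv.Perm (Option D) :=
  open Classical in σ.optionCongr * Equiv.swap none (some (σ⁻¹ c))

theorem insertBefore_none (σ : Equiv.Perm D) (c : D) : insertBefore σ c none = some c := by
  simp [insertBefore]

open Classical in
theorem insertBefore_some (σ : Equiv.Perm D) (c x : D) :
    insertBefore σ c (some x) = if σ x = c then none else some (σ x) := by
  classical
  by_cases h : σ x = c
  · subst h
    simp [insertBefore]
  · have hx : x ≠ σ⁻¹ c := by
      rintro rfl
      simp at h
    have hs : Equiv.swap (none : Option D) (some (σ⁻¹ c)) (some x) = some x :=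
      Equiv.swap_apply_of_ne_of_ne (by simp) (by simpa using hx)
    simp only [insertBefore, Equiv.Perm.mul_apply, if_neg h]
    convert congrArg σ.optionCongr hs using 1
    simp

theorem sameCycle_insertBefore (σ : Equiv.Perm D) (c : D) (x y : Option D) :
    (insertBefore σ c).SameCycle x y ↔ σ.SameCycle (x.getD c) (y.getD c) := by
  classical
  have step : ∀ z : Option D, σ.SameCycle (z.getD c) ((insertBefore σ c z).getD c) := by
    intro z
    cases z with
    | none => simp only [insertBefore_none, Option.getD]; exact Equiv.Perm.SameCycle.refl _ _
    | some z =>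
      rw [insertBefore_some]
      by_cases h : σ z = c
      · rw [if_pos h]
        exact ⟨1, by simp [h]⟩
      · rw [if_neg h]
        exact ⟨1, by simp⟩
  have lift1 : ∀ z : D, (insertBefore σ c).SameCycle (some z) (some (σ z)) := by
    intro z
    by_cases h : σ z = c
    · refine ⟨2, ?_⟩
      have : (insertBefore σ c) ((insertBefore σ c) (some z)) = some (σ z) := by
        rw [insertBefore_some, if_pos h, insertBefore_none, h]
      simpa [zpow_ofNat, pow_two] using this
    · refine ⟨1, ?_⟩
      rw [zpow_one, insertBefore_some, if_neg h]
  have getD_same : ∀ z : Option D, (insertBefore σ c).SameCycle z (some (z.getD c)) := by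
    intro z
    cases z with
    | none => exact ⟨1, by simp [insertBefore_none]⟩
    | some z => exact Equiv.Perm.SameCycle.refl _ _
  constructor
  · rintro ⟨i, rfl⟩
    induction i with
    | zero => simp [Equiv.Perm.SameCycle.refl]
    | succ i ih =>
      refine ih.trans ?_
      rw [add_comm, zpow_add, zpow_one, Equiv.Perm.mul_apply]
      exact step _
    | pred i ih =>
      refine ih.trans (Equiv.Perm.SameCycle.symm ?_)
      have := step (((insertBefore σ c) ^ (-(i : ℤ) - 1)) x)
      rw [← Equiv.Perm.mul_apply, ← zpow_one_add] at this
      simpa using this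
  · rintro ⟨i, hi⟩
    refine (getD_same x).trans (Equiv.Perm.SameCycle.trans ?_ (getD_same y).symm)
    rw [← hi]
    generalize x.getD c = z
    clear hi
    induction i with
    | zero => simp [Equiv.Perm.SameCycle.refl]
    | succ i ih =>
      refine ih.trans ?_
      rw [add_comm, zpow_add, zpow_one, Equiv.Perm.mul_apply]
      exact lift1 _
    | pred i ih =>
      refine ih.trans (Equiv.Perm.SameCycle.symm ?_)
      have := lift1 ((σ ^ (-(i : ℤ) - 1)) z)
      rw [← Equiv.Perm.mul_apply, ← zpow_one_add] at this
      simpa using this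

/-- Attaching the dangling extremity of the stem `s` to the angle just before `c`. The new dart
`none` is the other half of `s` and is inserted just before `c` around the vertex of `c`. The angle
`c` is split into the angles `none` (on the left of the oriented edge `s`) and `some c` (on its
right); in particular the root angle is kept on the right side of the extremity if `c` is the
root. -/
def attach (T : StemMap V D) (s c : D) (hs : T.IsStem s) : StemMap V (Option D) where
  vert x := T.vert (x.getD c)
  rot := insertBefore T.rot c
  flip := open Classical in T.flip.optionCongr * Equiv.swap none (some s)
  root := some T.root
  flip_flip := by
    classical
    intro x
    have hs' : T.flip s = s := hs
    have key : ∀ x, (T.flip.optionCongr * Equiv.swap none (some s)) x =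
        if x = none then some s else if x = some s then none else x.map T.flip := by
      intro x
      cases x with
      | none => simp [hs']
      | some x =>
        by_cases h : x = s
        · subst h; simp
        · have : Equiv.swap (none : Option D) (some s) (some x) = some x :=
            Equiv.swap_apply_of_ne_of_ne (by simp) (by simpa using h)
          simp [h, this]
    have goal : ∀ x, (T.flip.optionCongr * Equiv.swap none (some s))
        ((T.flip.optionCongr * Equiv.swap none (some s)) x) = x := by
      intro x
      rw [key x]
      cases x with
      | none => rw [key]; simp
      | some x =>
        by_cases h : x = s
        · subst h; rw [key]; simp
        · have h2 : T.flip x ≠ s := by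
            intro h3
            apply h
            rw [← T.flip_flip x, h3, hs']
          rw [key]; simp [h, h2, T.flip_flip]
    convert goal x
  vert_surjective v := by
    obtain ⟨d, rfl⟩ := T.vert_surjective v
    exact ⟨some d, rfl⟩
  vert_eq_iff x y := by
    rw [T.vert_eq_iff, sameCycle_insertBefore]

/-- The stem `s` is followed, clockwise along the border of its face, by two edges; that is,
`(e₁, e₂, s)` with `e₂` carried by the dart `face s` and `e₁` by `face (face s)` is an admissible
triple in counterclockwise order. -/
structure Admissible (T : StemMap V D) (s : D) : Prop where
  isStem : T.IsStem s
  edge₂ : ¬ T.IsStem (T.face s)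
  edge₁ : ¬ T.IsStem (T.face (T.face s))

/-- Closure of an admissible triple: the stem is attached to the angle reached after the two
edges, which creates a triangular face on its left. -/
def closeTriple (T : StemMap V D) (s : D) (hs : T.Admissible s) : StemMap V (Option D) :=
  T.attach s (T.face (T.face (T.face s))) hs.isStem

/-- `T.ClosesTo M`: the map `M` is obtained from `T` by successively closing admissible triples
(any number of them, in any order). -/
inductive ClosesTo.{u, v} {V : Type u} {D : Type v} (T : StemMap V D) :
    ∀ {D' : Type v}, StemMap V D' → Prop
  | refl : ClosesTo T T
  | close {D' : Type v} {M : StemMap V D'} (hM : ClosesTo T M) (s : D') (hs : M.Admissible s) :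
      ClosesTo T (M.closeTriple s hs)

/-- `G` is obtained from `T` by a complete closure: all stems have been attached. -/
def IsCompleteClosure.{u, v} {V : Type u} {D D' : Type v} (T : StemMap V D)
    (G : StemMap V D') : Prop :=
  T.ClosesTo G ∧ ∀ d, ¬ G.IsStem d

/-- The closure procedure never wraps over the root angle: whenever an admissible triple is
closed, the root angle is none of the two angles between the stem and its attachment angle, so that
it stays on the right side of the stem. -/
def IsSafe.{u, v} {V : Type u} {D : Type v} (T : StemMap V D) : Prop :=
  ∀ (D' : Type v) (M : StemMap V D'), T.ClosesTo M → ∀ s, M.Admissible s →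
    M.face s ≠ M.root ∧ M.face (M.face s) ≠ M.root

/-- Rooted, safe, balanced toroidal unicellular maps. -/
structure IsRootedSafeBalanced (T : StemMap V D) (n : ℕ) : Prop where
  unicellular : T.IsRootedUnicellular n
  safe : T.IsSafe
  balanced : T.IsBalanced

/-- The graph of a map on its vertices (graph distances see neither loops nor multiplicities). -/
def graph (G : StemMap V D) : SimpleGraph V where
  Adj u v := u ≠ v ∧ ∃ d, ¬ G.IsStem d ∧ G.vert d = u ∧ G.vert (G.flip d) = v
  symm := ⟨by
    rintro u v ⟨huv, d, hd, rfl, rfl⟩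
    refine ⟨huv.symm, G.flip d, ?_, rfl, by rw [G.flip_flip]⟩
    intro h
    exact hd (G.flip.injective h)⟩
  loopless := ⟨fun _ h => h.1 rfl⟩

/-! ### Labels

With the root half-edge added in the root angle, the angles around the unique face are
`a_0, …, a_ℓ` with `ℓ = Nat.card D`: the root angle is split by the half-edge into `a_0` (just after
it) and `a_ℓ` (just before it), and accordingly `angle 0 = angle ℓ = root`. -/

open Classical in
/-- The label `λ(a_i)`. -/
def label (T : StemMap V D) : ℕ → ℤ
  | 0 => 3
  | i + 1 => T.label i + if T.IsStem (T.angle i) then 1 else -1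

/-- The indices `i ≤ ℓ` such that `a_i` is incident to `v`. -/
def anglesAt (T : StemMap V D) (v : V) : Set ℕ := {i | i ≤ Nat.card D ∧ T.vert (T.angle i) = v}

/-- `m(v)`, the minimum label of the angles incident to `v`. -/
def minLabel (T : StemMap V D) (v : V) : ℤ := sInf (T.label '' T.anglesAt v)

/-- `b(v)`, the index of the first angle incident to `v`. -/
def first (T : StemMap V D) (v : V) : ℕ := sInf (T.anglesAt v)

/-- `m̄(u, v)`, the minimum label of the angles between the first angle incident to `u` and the
first angle incident to `v`. -/
def minBetween (T : StemMap V D) (u v : V) : ℤ :=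
  if T.first u ≤ T.first v then sInf (T.label '' Set.Icc (T.first u) (T.first v))
  else sInf (T.label '' Set.Icc (T.first v) (T.first u))

end StemMap

end

/-!
Let `a_0, …, a_ℓ` be the angles of `T` in the order of the clockwise tour of the face, with labels
`λ`. Call *successor* of `a_i` the first later angle whose label is smaller (it is then smaller by
one). The theorem combines two facts.

*The closure joins every angle to its successor.* An edge of `T` joins two consecutive angles, so
its clockwise side does so. A stem raises the label by one; when it is closed, the two edges that
follow it have already been joining angles to their successors, each lowering the label by one, so
the stem joins its angle to the successor of that angle (`IsPartialClosure.closeTriple`). Safety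
prevents the border of the outer face from wrapping over the root angle, so that it is always a
subsequence of the tour. While stems are left, some stem is followed by two edges, since the labels
decrease by three in each turn (`IsPartialClosure.exists_admissible`). Thus complete closures exist,
and in such a closure following successors from any angle leads down to the label `0`, which only the
final copy `a_ℓ` of the root angle has. Hence `d(v_0, v) ≤ m(v)`. Following successors from two
angles `a_i`, `a_j` with `i ≤ j` leads to a common angle, the first one after `a_j` with a label
smaller than all those between `a_i` and `a_j`; this bounds `d(u, v)`.

*The labels of the angles at one vertex differ by at most six* (`lab_le_add_six`, `lab_le_six`).
Along an edge of the closure, `m` then changes by at most `7`, which gives `m(v) ≤ 7 d(v_0, v)`, and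
the labels of the first angles of `u` and `v` exceed `m(u)` and `m(v)` by at most `6`, which gives
the constant `14 = 6 + 6 + 2`.

For the second fact, the variation of the labels around the half-edges is corrected into an
antisymmetric function on the darts, the *flow* (`flow`, `flow_flip`). Call *excess* of a vertex the
number of its outgoing edges minus one, plus one at the root; the excesses are nonnegative with sum
`2`. The tour cannot go forward all along a side of a cycle, so each of the two sides has an outgoing
edge or the root angle. The sum of the excesses being `2`, it is used up by the cycle: each side is
met in the order of the tour up to one turn (`rightSum_outInd`), and the special vertices are those
of positive excess (`isSpecial_iff`). With the prescribed stems every vertex has outdegree three, and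
the divergence of the flow is three times the excess, minus six at the root. Balancedness says that
the flux of the flow through each cycle is three, up to the root (`rightSum_flow`).

The same divergence is that of three times the flows from the root to angles of the special
vertices along the tour. The difference of the two is divergence-free, hence locally the variation
of a function on the angles. Its value at an edge is the variation of this function along the tour
between the two halves of the edge, that is, along the half-edges that cross the edge
(`eq_neg_rightSum_of_divergence_free`). These form a circulation, which is empty or a single cycle,
since the space of circulations of a map with one edge more than vertices has dimension two
(`exists_crossing_eq_image`). So the flow is known everywhere: it is `3` towards the root on crossed
edges (`flow_of_crossing_nonempty`) and `0`, `3` or `6` towards the root on the others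
(`flow_of_crossing_eq_empty`). Consequently, rotating around a vertex, the labels increase by at most
one around each of its three outgoing edges and stems, except for three more around the outgoing
half-edge of an uncrossed edge, of which there is at most one at each vertex and none at the root.
-/

noncomputable section

namespace StemMap

variable {V : Type*} {D : Type*}

/-! ### The tour of the unique face -/

/-- The map has exactly one face. -/
def IsUnicellular (T : StemMap V D) : Prop := ∀ d d', T.face.SameCycle d d'

/-- The position of the dart `x` in the clockwise tour of the face of the root angle. -/
def idx (T : StemMap V D) (x : D) : ℕ := sInf {i | T.angle i = x}

theorem rot_eq_face_flip (T : StemMap V D) (x : D) : T.rot x = T.face (T.flip x) := by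
  simp [face, T.flip_flip]

theorem face_apply (T : StemMap V D) (x : D) : T.face x = T.rot (T.flip x) := rfl

theorem vert_rot (T : StemMap V D) (x : D) : T.vert (T.rot x) = T.vert x := by
  rw [T.vert_eq_iff]
  exact ⟨-1, by simp⟩

theorem vert_rot_pow (T : StemMap V D) (x : D) (k : ℕ) : T.vert ((T.rot ^ k) x) = T.vert x := by
  induction k with
  | zero => simp
  | succ k ih => rw [pow_succ', Equiv.Perm.mul_apply, vert_rot, ih]

theorem vert_face (T : StemMap V D) (x : D) : T.vert (T.face x) = T.vert (T.flip x) := by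
  rw [face_apply, vert_rot]

theorem angle_zero (T : StemMap V D) : T.angle 0 = T.root := by simp [angle]

theorem angle_succ (T : StemMap V D) (i : ℕ) : T.angle (i + 1) = T.face (T.angle i) := by
  simp [angle, pow_succ']

theorem isStem_flip (T : StemMap V D) {x : D} : T.IsStem (T.flip x) ↔ T.IsStem x := by
  constructor
  · intro h
    exact T.flip.injective h
  · intro h
    have h' : T.flip x = x := h
    rw [h']
    exact h

theorem card_pos [Finite D] (T : StemMap V D) : 0 < Nat.card D :=
  haveI : Nonempty D := ⟨T.root⟩
  Nat.card_pos

theorem isCycleOn_face [Fintype D] {T : StemMap V D} (h : T.IsUnicellular) :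
    T.face.IsCycleOn ((Finset.univ : Finset D) : Set D) := by
  refine ⟨?_, fun x _ y _ => h x y⟩
  simp

theorem exists_angle_eq [Finite D] {T : StemMap V D} (h : T.IsUnicellular) (x : D) :
    ∃ i < Nat.card D, T.angle i = x := by
  have := Fintype.ofFinite D
  rw [Nat.card_eq_fintype_card]
  exact (isCycleOn_face h).exists_pow_eq (Finset.mem_univ _) (Finset.mem_univ _)

theorem angle_card [Finite D] {T : StemMap V D} (h : T.IsUnicellular) :
    T.angle (Nat.card D) = T.root := by
  have := Fintype.ofFinite D
  rw [Nat.card_eq_fintype_card]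
  exact (isCycleOn_face h).pow_card_apply (Finset.mem_univ _)

theorem angle_idx [Finite D] {T : StemMap V D} (h : T.IsUnicellular) (x : D) :
    T.angle (T.idx x) = x := by
  obtain ⟨i, -, hi⟩ := exists_angle_eq h x
  exact Nat.sInf_mem (s := {i | T.angle i = x}) ⟨i, hi⟩

theorem idx_lt [Finite D] {T : StemMap V D} (h : T.IsUnicellular) (x : D) :
    T.idx x < Nat.card D := by
  obtain ⟨i, hi, hx⟩ := exists_angle_eq h x
  exact (Nat.sInf_le (s := {i | T.angle i = x}) hx).trans_lt hi

theorem idx_injective [Finite D] {T : StemMap V D}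
    (h : T.IsUnicellular) : Function.Injective T.idx :=
  fun x y hxy => by rw [← angle_idx h x, hxy, angle_idx h y]

theorem idx_angle [Finite D] {T : StemMap V D} (h : T.IsUnicellular) {i : ℕ} (hi : i < Nat.card D) :
    T.idx (T.angle i) = i := by
  have := Fintype.ofFinite D
  have h1 := (isCycleOn_face h).pow_apply_eq_pow_apply (Finset.mem_univ T.root)
    (m := T.idx (T.angle i)) (n := i)
  have h2 : T.idx (T.angle i) ≡ i [MOD (Finset.univ : Finset D).card] :=
    h1.1 (angle_idx h (T.angle i))
  have h3 := idx_lt h (T.angle i)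
  rw [Nat.card_eq_fintype_card] at hi h3
  exact Nat.ModEq.eq_of_lt_of_lt h2 h3 hi

theorem idx_root [Finite D] {T : StemMap V D} (h : T.IsUnicellular) : T.idx T.root = 0 := by
  have := idx_angle h (T.card_pos)
  rwa [angle_zero] at this

theorem idx_face_of_ne [Finite D] {T : StemMap V D} (h : T.IsUnicellular) {x : D}
    (hx : T.face x ≠ T.root) :
    T.idx (T.face x) = T.idx x + 1 := by
  have h1 : T.angle (T.idx x + 1) = T.face x := by rw [angle_succ, angle_idx h]
  have h2 : T.idx x + 1 < Nat.card D := by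
    refine lt_of_le_of_ne (idx_lt h x) fun h3 => hx ?_
    rw [← h1, h3, angle_card h]
  rw [← h1, idx_angle h h2]

theorem idx_of_face_eq_root [Finite D] {T : StemMap V D} (h : T.IsUnicellular) {x : D}
    (hx : T.face x = T.root) : T.idx x + 1 = Nat.card D := by
  by_contra h3
  have h2 : T.idx x + 1 < Nat.card D := lt_of_le_of_ne (idx_lt h x) h3
  have h1 : T.angle (T.idx x + 1) = T.face x := by rw [angle_succ, angle_idx h]
  have := idx_angle h h2
  rw [h1, hx, idx_root h] at this
  omega

theorem idx_flip_ne [Finite D] {T : StemMap V D} (h : T.IsUnicellular) {x : D} (hx : ¬ T.IsStem x) :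
    T.idx (T.flip x) ≠ T.idx x := fun h1 => hx (idx_injective h h1)

/-! ### Labels and orientation of darts -/

open Classical in
/-- The increment of the labels when the dart `x` is passed in the tour of the face. -/
def step (T : StemMap V D) (x : D) : ℤ := if T.IsStem x then 1 else -1

/-- The label of the angle named by `x`; the root angle gets its initial label. -/
def lab (T : StemMap V D) (x : D) : ℤ := T.label (T.idx x)

/-- The dart `x` belongs to an edge and is met after its other half in the tour. -/
def OutEdge (T : StemMap V D) (x : D) : Prop := T.idx (T.flip x) < T.idx x

open Classical in
/-- The indicator function of the outgoing half-edges of edges. -/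
def outInd (T : StemMap V D) (x : D) : ℤ := if T.OutEdge x then 1 else 0

open Classical in
/-- The indicator function of the stems. -/
def stemInd (T : StemMap V D) (x : D) : ℤ := if T.IsStem x then 1 else 0

theorem not_isStem_of_outEdge {T : StemMap V D} {x : D} (hx : T.OutEdge x) : ¬ T.IsStem x := by
  intro h
  have h' : T.flip x = x := h
  rw [OutEdge, h'] at hx
  exact lt_irrefl _ hx

theorem outInd_add_flip [Finite D] {T : StemMap V D} (h : T.IsUnicellular) (x : D) :
    T.outInd x + T.outInd (T.flip x) = 1 - T.stemInd x := by
  unfold outInd stemInd OutEdge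
  rw [T.flip_flip]
  by_cases hx : T.IsStem x
  · have h' : T.flip x = x := hx
    simp [hx, h']
  · have := idx_flip_ne h hx
    rcases lt_or_gt_of_ne this with h1 | h1
    · simp [hx, h1, h1.le]
    · simp [hx, h1, h1.le]

theorem isOut_iff [Finite D] {T : StemMap V D} (h : T.IsUnicellular) (x : D) :
    T.IsOut x ↔ T.IsStem x ∨ T.OutEdge x := by
  unfold IsOut OutEdge
  refine or_congr Iff.rfl ⟨?_, ?_⟩
  · rintro ⟨i, j, hij, hj, h1, h2⟩
    rw [← h1, ← h2, idx_angle h hj, idx_angle h (hij.trans hj)]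
    exact hij
  · intro h1
    exact ⟨_, _, h1, idx_lt h x, angle_idx h _, angle_idx h _⟩

theorem step_flip (T : StemMap V D) (x : D) : T.step (T.flip x) = T.step x := by
  have h := T.isStem_flip (x := x)
  unfold step
  split_ifs <;> tauto

theorem lab_root [Finite D] {T : StemMap V D} (h : T.IsUnicellular) : T.lab T.root = 3 := by
  simp [lab, idx_root h, label]

theorem label_succ {T : StemMap V D} (i : ℕ) :
    T.label (i + 1) = T.label i + T.step (T.angle i) := by
  simp [label, step]

open Classical in
theorem lab_face [Finite D] {T : StemMap V D} (h : T.IsUnicellular) (hl : T.label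
    (Nat.card D) = 0) (x : D) :
    T.lab (T.face x) = T.lab x + T.step x + if T.face x = T.root then 3 else 0 := by
  have h0 : T.label (T.idx x + 1) = T.lab x + T.step x := by
    rw [label_succ, angle_idx h, lab]
  split_ifs with hx
  · rw [hx, lab_root h, ← h0, idx_of_face_eq_root h hx, hl]
    simp
  · rw [← h0, lab, idx_face_of_ne h hx]
    simp

theorem label_eq_sum [Fintype D] {T : StemMap V D} (h : T.IsUnicellular) :
    T.label (Nat.card D) = 3 + ∑ x, T.step x := by
  have h1 : ∀ i, T.label i = 3 + ∑ j ∈ Finset.range i, T.step (T.angle j) := by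
    intro i
    induction i with
    | zero => simp [label]
    | succ i ih => rw [label_succ, ih, Finset.sum_range_succ, add_assoc]
  rw [h1]
  congr 1
  refine Finset.sum_bij' (fun i _ => T.angle i) (fun x _ => T.idx x) ?_ ?_ ?_ ?_ ?_
  · simp
  · intro x _
    exact Finset.mem_range.2 (idx_lt h x)
  · intro i hi
    exact idx_angle h (Finset.mem_range.1 hi)
  · intro x _
    exact angle_idx h x
  · simp

/-! ### Sums over the darts of a vertex -/

open Classical in
/-- The darts attached to the vertex `v`. -/
def dartsAt [Fintype D] (T : StemMap V D) (v : V) : Finset D :=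
  Finset.univ.filter fun x => T.vert x = v

theorem mem_dartsAt [Fintype D] {T : StemMap V D} {v : V} {x : D} :
    x ∈ T.dartsAt v ↔ T.vert x = v := by simp [dartsAt]

theorem dartsAt_nonempty [Fintype D] (T : StemMap V D) (v : V) : (T.dartsAt v).Nonempty := by
  obtain ⟨x, hx⟩ := T.vert_surjective v
  exact ⟨x, mem_dartsAt.2 hx⟩

theorem sum_dartsAt_rot [Fintype D] {M : Type*} [AddCommMonoid M] (T : StemMap V D) (v : V)
    (g : D → M) : ∑ x ∈ T.dartsAt v, g (T.rot x) = ∑ x ∈ T.dartsAt v, g x := by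
  refine Finset.sum_bij (fun x _ => T.rot x) ?_ ?_ ?_ ?_
  · intro x hx
    rw [mem_dartsAt] at hx ⊢
    rw [vert_rot, hx]
  · intro x _ y _ hxy
    exact T.rot.injective hxy
  · intro y hy
    refine ⟨T.rot⁻¹ y, ?_, by simp⟩
    rw [mem_dartsAt] at hy ⊢
    rw [← T.vert_rot]
    simpa using hy
  · simp

theorem sum_dartsAt_rot_sub [Fintype D] (T : StemMap V D) (v : V) (g : D → ℤ) :
    ∑ x ∈ T.dartsAt v, (g (T.rot x) - g x) = 0 := by
  rw [Finset.sum_sub_distrib, sum_dartsAt_rot, sub_self]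

theorem sum_sum_dartsAt [Fintype D] [Fintype V] {M : Type*} [AddCommMonoid M] (T : StemMap V D)
    (g : D → M) : ∑ v, ∑ x ∈ T.dartsAt v, g x = ∑ x, g x := by
  classical
  rw [← Finset.sum_fiberwise Finset.univ T.vert g]
  refine Finset.sum_congr rfl fun v _ => Finset.sum_congr ?_ fun _ _ => rfl
  ext x
  simp [mem_dartsAt]

open Classical in
theorem sum_dartsAt_rot_eq [Fintype D] (T : StemMap V D) (v : V) (y : D) :
    ∑ x ∈ T.dartsAt v, (if T.rot x = y then (1 : ℤ) else 0) = if T.vert y = v then 1 else 0 := by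
  rw [sum_dartsAt_rot T v fun x => if x = y then (1 : ℤ) else 0]
  simp [mem_dartsAt]

/-! ### Arcs around a vertex -/

open Classical in
/-- The darts strictly between `a` and `b` in counterclockwise order. -/
def arc [Fintype D] (T : StemMap V D) (a b : D) : Finset D :=
  Finset.univ.filter fun x => T.Between a b x

theorem mem_arc [Fintype D] {T : StemMap V D} {a b x : D} : x ∈ T.arc a b ↔ T.Between a b x := by
  simp [arc]

/-- The darts strictly between `a` and `b` are `rot a, …, rot ^ (m - 1) a`, where
`rot ^ m` is the first positive power that maps `a` to `b`. -/
theorem exists_arc_eq [Fintype D] [DecidableEq D] (T : StemMap V D) {a b : D} (hab : a ≠ b)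
    (hv : T.vert a = T.vert b) :
    ∃ m, 0 < m ∧ (T.rot ^ m) a = b ∧
      Set.InjOn (fun k => (T.rot ^ k) a) (Finset.range (m + 1)) ∧
      T.arc a b = (Finset.Ico 1 m).image fun k => (T.rot ^ k) a := by
  have hex : ∃ m, (T.rot ^ m) a = b := ((T.vert_eq_iff a b).1 hv).exists_nat_pow_eq
  classical
  set m := Nat.find hex with hm
  have hmb : (T.rot ^ m) a = b := Nat.find_spec hex
  have hmin : ∀ k < m, (T.rot ^ k) a ≠ b := fun k hk => Nat.find_min hex hk
  have hm0 : 0 < m := by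
    rcases Nat.eq_zero_or_pos m with h | h
    · rw [h] at hmb
      exact absurd hmb hab
    · exact h
  -- a repetition before time `m` would let `b` be reached earlier
  have hlt : ∀ i j, i < j → j ≤ m → (T.rot ^ i) a ≠ (T.rot ^ j) a := by
    intro i j hij hj h
    have h1 : (T.rot ^ (i + (m - j))) a = b := by
      rw [add_comm, pow_add, Equiv.Perm.mul_apply, h, ← Equiv.Perm.mul_apply, ← pow_add,
        Nat.sub_add_cancel hj, hmb]
    exact hmin _ (by omega) h1
  refine ⟨m, hm0, hmb, ?_, ?_⟩
  · intro i hi j hj hij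
    simp only [Finset.coe_range, Set.mem_Iio] at hi hj
    rcases lt_trichotomy i j with h | h | h
    · exact absurd hij (hlt i j h (by omega))
    · exact h
    · exact absurd hij.symm (hlt j i h (by omega))
  · ext x
    simp only [mem_arc, Finset.mem_image, Finset.mem_Ico]
    constructor
    · rintro ⟨i, hi, hx, h⟩
      refine ⟨i, ⟨hi, ?_⟩, hx⟩
      by_contra hc
      exact h m hm0 (by omega) hmb
    · rintro ⟨i, ⟨hi, him⟩, hx⟩
      exact ⟨i, hi, hx, fun j _ hj => hmin j (by omega)⟩

theorem sum_arc [Fintype D] (T : StemMap V D) {a b : D} (hab : a ≠ b)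
    (hv : T.vert a = T.vert b) (g : D → ℤ) :
    ∑ x ∈ T.arc a b, (g (T.rot x) - g x) = g b - g (T.rot a) := by
  classical
  obtain ⟨m, hm, hb, hinj, harc⟩ := T.exists_arc_eq hab hv
  rw [harc, Finset.sum_image]
  · have h1 : ∀ k, g (T.rot ((T.rot ^ k) a)) - g ((T.rot ^ k) a)
        = (fun k => g ((T.rot ^ k) a)) (k + 1) - (fun k => g ((T.rot ^ k) a)) k := by
      intro k
      simp [pow_succ']
    simp_rw [h1]
    rw [Finset.sum_Ico_sub (fun k => g ((T.rot ^ k) a)) hm]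
    simp [hb]
  · intro i hi j hj hij
    simp only [Finset.coe_Ico, Set.mem_Ico] at hi hj
    exact hinj (by simp; omega) (by simp; omega) hij

theorem vert_of_mem_arc [Fintype D] {T : StemMap V D} {a b x : D} (hx : x ∈ T.arc a b) :
    T.vert x = T.vert a := by
  obtain ⟨i, -, rfl, -⟩ := mem_arc.1 hx
  exact T.vert_rot_pow a i

theorem left_notMem_arc [Fintype D] {T : StemMap V D} {a b : D} (hab : a ≠ b)
    (hv : T.vert a = T.vert b) : a ∉ T.arc a b := by
  classical
  obtain ⟨m, hm, hb, hinj, harc⟩ := T.exists_arc_eq hab hv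
  rw [harc]
  intro h
  obtain ⟨k, hk, hka⟩ := Finset.mem_image.1 h
  rw [Finset.mem_Ico] at hk
  have := @hinj k (by simp; omega) 0 (by simp) (by simpa using hka)
  omega

theorem right_notMem_arc [Fintype D] {T : StemMap V D} {a b : D} : b ∉ T.arc a b := by
  intro h
  obtain ⟨i, hi, hb, h⟩ := mem_arc.1 h
  exact h i hi le_rfl hb

/-- Two darts at a vertex cut the darts of this vertex into two arcs. The proof shows that the
number of times that a dart is counted by the two arcs and their ends is invariant under rotation,
hence equal to its value `1` at `a`. -/
theorem sum_arc_add_sum_arc [Fintype D] (T : StemMap V D) {a b : D} (hab : a ≠ b)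
    (hv : T.vert a = T.vert b) (g : D → ℤ) :
    ∑ x ∈ T.arc a b, g x + ∑ x ∈ T.arc b a, g x + (g a + g b)
      = ∑ x ∈ T.dartsAt (T.vert a), g x := by
  classical
  set u : D → ℤ := fun y => (if y ∈ T.arc a b then (1 : ℤ) else 0)
    + (if y ∈ T.arc b a then (1 : ℤ) else 0)
    + ((if y = a then (1 : ℤ) else 0) + (if y = b then (1 : ℤ) else 0)) with hu
  have hsum : ∀ h : D → ℤ, ∑ y, u y * h y
      = ∑ x ∈ T.arc a b, h x + ∑ x ∈ T.arc b a, h x + (h a + h b) := by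
    intro h
    simp only [hu, add_mul, Finset.sum_add_distrib, ite_mul, one_mul, zero_mul,
      Finset.sum_ite_mem, Finset.univ_inter, Finset.sum_ite_eq', Finset.mem_univ, if_true]
  have hinv : ∀ z, u (T.rot z) = u z := by
    intro z
    have h0 : ∑ y, u y * ((if T.rot y = T.rot z then (1 : ℤ) else 0)
        - (if y = T.rot z then (1 : ℤ) else 0)) = 0 := by
      rw [hsum]
      rw [T.sum_arc hab hv fun y => if y = T.rot z then (1 : ℤ) else 0,
        T.sum_arc hab.symm hv.symm fun y => if y = T.rot z then (1 : ℤ) else 0]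
      ring
    simp only [mul_sub, Finset.sum_sub_distrib, EmbeddingLike.apply_eq_iff_eq, mul_ite, mul_one,
      mul_zero, Finset.sum_ite_eq', Finset.mem_univ, if_true] at h0
    linarith
  have hua : u a = 1 := by
    simp [hu, left_notMem_arc hab hv, right_notMem_arc, hab]
  have hone : ∀ y, T.vert y = T.vert a → u y = 1 := by
    intro y hy
    obtain ⟨k, rfl⟩ := ((T.vert_eq_iff a y).1 hy.symm).exists_nat_pow_eq
    clear hy
    induction k with
    | zero => simpa using hua
    | succ k ih => rw [pow_succ', Equiv.Perm.mul_apply, hinv, ih]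
  have hzero : ∀ y, T.vert y ≠ T.vert a → u y = 0 := by
    intro y hy
    have h1 : y ∉ T.arc a b := fun h => hy (vert_of_mem_arc h)
    have h2 : y ∉ T.arc b a := fun h => hy ((vert_of_mem_arc h).trans hv.symm)
    have h3 : y ≠ a := fun h => hy (by rw [h])
    have h4 : y ≠ b := fun h => hy (by rw [h, hv])
    simp [hu, h1, h2, h3, h4]
  rw [← hsum, dartsAt, Finset.sum_filter]
  refine Finset.sum_congr rfl fun y _ => ?_
  split_ifs with h
  · rw [hone y h, one_mul]
  · rw [hzero y h, zero_mul]

/-! ### The two sides of a cycle -/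

/-- The sum of `g` over the darts incident to the right side of the cycle `c`. -/
def rightSum [Fintype D] (T : StemMap V D) {k : ℕ} (c : Fin (k + 1) → D) (g : D → ℤ) : ℤ :=
  ∑ i, ∑ x ∈ T.arc (T.flip (c i)) (c (i + 1)), g x

/-- The sum of `g` over the darts incident to the left side of the cycle `c`. -/
def leftSum [Fintype D] (T : StemMap V D) {k : ℕ} (c : Fin (k + 1) → D) (g : D → ℤ) : ℤ :=
  ∑ i, ∑ x ∈ T.arc (c (i + 1)) (T.flip (c i)), g x

/-- The cycle `c` traversed backwards. -/
def reverse (T : StemMap V D) {k : ℕ} (c : Fin (k + 1) → D) : Fin (k + 1) → D :=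
  fun i => T.flip (c (-i))

theorem sum_fin_succ {k : ℕ} {M : Type*} [AddCommMonoid M] (g : Fin (k + 1) → M) :
    ∑ i, g (i + 1) = ∑ i, g i :=
  Equiv.sum_comp (Equiv.addRight (1 : Fin (k + 1))) g

theorem isCycle_reverse {T : StemMap V D} {k : ℕ} {c : Fin (k + 1) → D} (hc : T.IsCycle c) :
    T.IsCycle (T.reverse c) where
  vert_flip i := by
    simp only [reverse, T.flip_flip]
    rw [hc.vert_flip]
    congr 2
    abel
  injective i j hij := by
    simp only [reverse, hc.vert_flip] at hij
    have := hc.injective hij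
    simpa using this
  flip_ne i j h := by
    simp only [reverse, T.flip_flip] at h
    exact hc.flip_ne (-j) (-i) h.symm

theorem rightSum_reverse [Fintype D] (T : StemMap V D) {k : ℕ} (c : Fin (k + 1) → D)
    (g : D → ℤ) : T.rightSum (T.reverse c) g = T.leftSum c g := by
  unfold rightSum leftSum reverse
  refine Fintype.sum_equiv ((Equiv.neg _).trans (Equiv.addRight (-1))) _ _ fun i => ?_
  simp only [T.flip_flip, Equiv.trans_apply, Equiv.neg_apply, Equiv.coe_addRight]
  rw [show -i + -1 + 1 = -i by abel, show -(i + 1) = -i + -1 by abel]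

/-- Telescoping along the right side of a cycle. -/
theorem rightSum_rot_sub [Fintype D] {T : StemMap V D} {k : ℕ} {c : Fin (k + 1) → D}
    (hc : T.IsCycle c) (g : D → ℤ) :
    T.rightSum c (fun x => g (T.rot x) - g x) = ∑ i, (g (c i) - g (T.face (c i))) := by
  unfold rightSum
  rw [Finset.sum_sub_distrib, ← sum_fin_succ fun i => g (c i), ← Finset.sum_sub_distrib]
  exact Finset.sum_congr rfl fun i _ => T.sum_arc (hc.flip_ne _ _) (hc.vert_flip i) g

theorem rightSum_add_leftSum [Fintype D] {T : StemMap V D} {k : ℕ} {c : Fin (k + 1) → D}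
    (hc : T.IsCycle c) (g : D → ℤ) :
    T.rightSum c g + T.leftSum c g + ∑ i, (g (c i) + g (T.flip (c i)))
      = ∑ i, ∑ x ∈ T.dartsAt (T.vert (c i)), g x := by
  unfold rightSum leftSum
  rw [← sum_fin_succ fun i => ∑ x ∈ T.dartsAt (T.vert (c i)), g x, Finset.sum_add_distrib,
    ← sum_fin_succ fun i => g (c i), ← Finset.sum_add_distrib, ← Finset.sum_add_distrib,
    ← Finset.sum_add_distrib]
  refine Finset.sum_congr rfl fun i _ => ?_
  rw [← hc.vert_flip, ← T.sum_arc_add_sum_arc (hc.flip_ne _ _) (hc.vert_flip i)]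
  ring

theorem rightSum_nonneg [Fintype D] (T : StemMap V D) {k : ℕ} (c : Fin (k + 1) → D) {g : D → ℤ}
    (hg : ∀ x, 0 ≤ g x) : 0 ≤ T.rightSum c g :=
  Finset.sum_nonneg fun _ _ => Finset.sum_nonneg fun _ _ => hg _

theorem rightSum_add [Fintype D] (T : StemMap V D) {k : ℕ} (c : Fin (k + 1) → D) (g h : D → ℤ) :
    T.rightSum c (fun x => g x + h x) = T.rightSum c g + T.rightSum c h := by
  simp [rightSum, Finset.sum_add_distrib]

theorem rightSum_sub [Fintype D] (T : StemMap V D) {k : ℕ} (c : Fin (k + 1) → D) (g h : D → ℤ) :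
    T.rightSum c (fun x => g x - h x) = T.rightSum c g - T.rightSum c h := by
  simp [rightSum, Finset.sum_sub_distrib]

theorem rightSum_const_mul [Fintype D] (T : StemMap V D) {k : ℕ} (c : Fin (k + 1) → D) (a : ℤ)
    (g : D → ℤ) : T.rightSum c (fun x => a * g x) = a * T.rightSum c g := by
  simp [rightSum, Finset.mul_sum]

open Classical in
/-- The indicator function of the angles lying on the right side of the cycle `c`: such an angle
is reached either by walking along the cycle or by passing a dart on the right side. -/
def inRight [Fintype D] (T : StemMap V D) {k : ℕ} (c : Fin (k + 1) → D) (y : D) : ℤ :=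
  T.rightSum c (fun x => if T.rot x = y then 1 else 0) + ∑ i, if T.face (c i) = y then 1 else 0

open Classical in
theorem inRight_eq [Fintype D] {T : StemMap V D} {k : ℕ} {c : Fin (k + 1) → D}
    (hc : T.IsCycle c) (y : D) :
    T.inRight c y = T.rightSum c (fun x => if x = y then 1 else 0)
      + ∑ i, if c i = y then 1 else 0 := by
  have h := rightSum_rot_sub hc fun x => if x = y then 1 else 0
  rw [rightSum_sub, Finset.sum_sub_distrib] at h
  unfold inRight
  linarith

theorem inRight_nonneg [Fintype D] (T : StemMap V D) {k : ℕ} (c : Fin (k + 1) → D) (y : D) :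
    0 ≤ T.inRight c y := by
  classical
  refine add_nonneg (T.rightSum_nonneg c fun x => ?_) (Finset.sum_nonneg fun i _ => ?_) <;>
    split_ifs <;> norm_num

/-- An angle of a vertex of a cycle lies on exactly one side of the cycle. -/
theorem inRight_add_inRight_reverse [Fintype D] {T : StemMap V D} {k : ℕ} {c : Fin (k + 1) → D}
    (hc : T.IsCycle c) {y : D} (hy : ∃ i, T.vert (c i) = T.vert y) :
    T.inRight c y + T.inRight (T.reverse c) y = 1 := by
  classical
  rw [inRight_eq hc, inRight_eq (isCycle_reverse hc), rightSum_reverse]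
  have h := rightSum_add_leftSum hc fun x => if x = y then (1 : ℤ) else 0
  have h2 : ∑ i, (if T.reverse c i = y then (1 : ℤ) else 0)
      = ∑ i, if T.flip (c i) = y then 1 else 0 :=
    Fintype.sum_equiv (Equiv.neg _) _ _ fun i => rfl
  have h3 : ∑ i, ∑ x ∈ T.dartsAt (T.vert (c i)), (if x = y then (1 : ℤ) else 0) = 1 := by
    obtain ⟨i, hi⟩ := hy
    rw [Finset.sum_eq_single i]
    · simp [mem_dartsAt, hi]
    · intro j _ hj
      have : T.vert y ≠ T.vert (c j) := fun h => hj (hc.injective (h.symm.trans hi.symm))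
      simp [mem_dartsAt, this]
    · simp
  rw [Finset.sum_add_distrib] at h
  rw [h2]
  linarith

theorem inRight_add_inRight_reverse_of_forall_ne [Fintype D] {T : StemMap V D} {k : ℕ}
    {c : Fin (k + 1) → D} (hc : T.IsCycle c) {y : D} (hy : ∀ i, T.vert (c i) ≠ T.vert y) :
    T.inRight c y + T.inRight (T.reverse c) y = 0 := by
  classical
  rw [inRight_eq hc, inRight_eq (isCycle_reverse hc), rightSum_reverse]
  have h := rightSum_add_leftSum hc fun x => if x = y then (1 : ℤ) else 0
  have h2 : ∑ i, (if T.reverse c i = y then (1 : ℤ) else 0)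
      = ∑ i, if T.flip (c i) = y then 1 else 0 :=
    Fintype.sum_equiv (Equiv.neg _) _ _ fun i => rfl
  have h3 : ∑ i, ∑ x ∈ T.dartsAt (T.vert (c i)), (if x = y then (1 : ℤ) else 0) = 0 := by
    refine Finset.sum_eq_zero fun i _ => ?_
    simp [mem_dartsAt, (hy i).symm]
  rw [Finset.sum_add_distrib] at h
  rw [h2]
  linarith

/-- The angle from which a cycle leaves one of its vertices is on its right side. -/
theorem inRight_self [Fintype D] {T : StemMap V D} {k : ℕ} {c : Fin (k + 1) → D}
    (hc : T.IsCycle c) (i : Fin (k + 1)) : T.inRight c (c i) = 1 := by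
  classical
  have h1 := inRight_add_inRight_reverse hc (y := c i) ⟨i, rfl⟩
  have h2 := inRight_nonneg T (T.reverse c) (c i)
  have h3 : 1 ≤ T.inRight c (c i) := by
    rw [inRight_eq hc]
    have h4 : 0 ≤ T.rightSum c (fun x => if x = c i then 1 else 0) :=
      T.rightSum_nonneg c fun x => by split_ifs <;> norm_num
    have h5 : (if c i = c i then (1 : ℤ) else 0) ≤ ∑ j, if c j = c i then (1 : ℤ) else 0 :=
      Finset.single_le_sum (f := fun j => if c j = c i then (1 : ℤ) else 0)
        (fun j _ => by split_ifs <;> norm_num) (Finset.mem_univ i)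
    simp only [if_true] at h5
    linarith
  linarith

/-! ### Excess of the vertices -/

theorem not_isStem_of_isCycle {T : StemMap V D} {k : ℕ} {c : Fin (k + 1) → D} (hc : T.IsCycle c)
    (i : Fin (k + 1)) : ¬ T.IsStem (c i) := hc.flip_ne i i

theorem outInd_nonneg (T : StemMap V D) (x : D) : 0 ≤ T.outInd x := by
  unfold outInd; split_ifs <;> norm_num

theorem stemInd_of_isStem {T : StemMap V D} {x : D} (hx : T.IsStem x) : T.stemInd x = 1 := by
  simp [stemInd, hx]

theorem stemInd_of_not {T : StemMap V D} {x : D} (hx : ¬ T.IsStem x) : T.stemInd x = 0 := by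
  simp [stemInd, hx]

theorem step_eq (T : StemMap V D) (x : D) : T.step x = 2 * T.stemInd x - 1 := by
  unfold step stemInd; split_ifs <;> norm_num

theorem stemInd_flip (T : StemMap V D) (x : D) : T.stemInd (T.flip x) = T.stemInd x := by
  have h1 := T.step_eq x
  have h2 := T.step_eq (T.flip x)
  rw [step_flip] at h2
  linarith

/-- Rotation around a vertex goes forward in the tour of the face, except when it passes an
outgoing half-edge of an edge or arrives at the root angle. -/
theorem idx_lt_idx_rot [Finite D] {T : StemMap V D} (h : T.IsUnicellular) {x : D}
    (hx : ¬ T.OutEdge x) (hr : T.rot x ≠ T.root) : T.idx x < T.idx (T.rot x) := by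
  rw [rot_eq_face_flip] at hr ⊢
  rw [idx_face_of_ne h hr]
  unfold OutEdge at hx
  omega

/-- The right side of a cycle either contains the root angle or is incident to an outgoing
half-edge of an edge, since the tour of the face cannot go forward all along. -/
theorem one_le_rightSum_outInd_add [Fintype D] {T : StemMap V D} (h : T.IsUnicellular) {k : ℕ}
    {c : Fin (k + 1) → D} (hc : T.IsCycle c) :
    1 ≤ T.rightSum c T.outInd + T.inRight c T.root := by
  classical
  have h1 := T.rightSum_nonneg c T.outInd_nonneg
  have h2 := T.inRight_nonneg c T.root
  by_contra hlt
  have h3 : T.rightSum c T.outInd = 0 := by linarith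
  have h4 : T.inRight c T.root = 0 := by linarith
  have h5 : T.rightSum c (fun x => if T.rot x = T.root then 1 else 0) = 0 ∧
      ∑ i, (if T.face (c i) = T.root then (1 : ℤ) else 0) = 0 := by
    have ha : 0 ≤ T.rightSum c (fun x => if T.rot x = T.root then 1 else 0) :=
      T.rightSum_nonneg c fun x => by split_ifs <;> norm_num
    have hb : 0 ≤ ∑ i, (if T.face (c i) = T.root then (1 : ℤ) else 0) :=
      Finset.sum_nonneg fun x _ => by split_ifs <;> norm_num
    unfold inRight at h4
    constructor <;> linarith
  have hface : ∀ i, T.face (c i) ≠ T.root := by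
    intro i hi
    have := (Finset.sum_eq_zero_iff_of_nonneg fun x _ => by split_ifs <;> norm_num).1 h5.2 i
      (Finset.mem_univ i)
    simp [hi] at this
  have hzero : ∀ g : D → ℤ, (∀ x, 0 ≤ g x) → T.rightSum c g = 0 →
      ∀ i, ∀ x ∈ T.arc (T.flip (c i)) (c (i + 1)), g x = 0 := by
    intro g hg h0 i
    have := (Finset.sum_eq_zero_iff_of_nonneg fun i _ => Finset.sum_nonneg fun x _ => hg x).1 h0 i
      (Finset.mem_univ i)
    exact (Finset.sum_eq_zero_iff_of_nonneg fun x _ => hg x).1 this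
  have h6 := rightSum_rot_sub hc fun x => (T.idx x : ℤ)
  have h7 : 0 ≤ T.rightSum c fun x => (T.idx (T.rot x) : ℤ) - T.idx x := by
    refine Finset.sum_nonneg fun i _ => Finset.sum_nonneg fun x hx => ?_
    have e1 := hzero _ T.outInd_nonneg h3 i x hx
    have e2 := hzero _ (fun x => by split_ifs <;> norm_num) h5.1 i x hx
    have e3 : ¬ T.OutEdge x := by
      intro ho
      simp [outInd, ho] at e1
    have e4 : T.rot x ≠ T.root := by
      intro ho
      simp [ho] at e2
    have := idx_lt_idx_rot h e3 e4
    omega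
  have h8 : ∑ i, ((T.idx (c i) : ℤ) - T.idx (T.face (c i))) = -(k + 1 : ℤ) := by
    rw [Finset.sum_congr rfl fun i _ => by rw [idx_face_of_ne h (hface i)]]
    simp
  rw [h8] at h6
  rw [h6] at h7
  have : (0 : ℤ) ≤ k := Int.natCast_nonneg k
  linarith

open Classical in
/-- The excess of a vertex: how many more outgoing edges it has than in a plane tree, where each
vertex but the root has one. -/
def excess [Fintype D] (T : StemMap V D) (v : V) : ℤ :=
  ∑ x ∈ T.dartsAt v, T.outInd x - 1 + if v = T.rootVertex then 1 else 0

theorem excess_nonneg [Fintype D] {T : StemMap V D} (h : T.IsUnicellular) (v : V) :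
    0 ≤ T.excess v := by
  classical
  have h1 : 0 ≤ ∑ x ∈ T.dartsAt v, T.outInd x := Finset.sum_nonneg fun x _ => T.outInd_nonneg x
  unfold excess
  split_ifs with hv
  · linarith
  · by_contra hlt
    have h0 : ∑ x ∈ T.dartsAt v, T.outInd x = 0 := by linarith
    have h2 := (Finset.sum_eq_zero_iff_of_nonneg fun x _ => T.outInd_nonneg x).1 h0
    have h3 := T.sum_dartsAt_rot_sub v fun x => (T.idx x : ℤ)
    have h4 : 0 < ∑ x ∈ T.dartsAt v, ((T.idx (T.rot x) : ℤ) - T.idx x) := by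
      refine Finset.sum_pos (fun x hx => ?_) (T.dartsAt_nonempty v)
      have e1 : ¬ T.OutEdge x := by
        intro ho
        simpa [outInd, ho] using h2 x hx
      have e2 : T.rot x ≠ T.root := by
        intro ho
        rw [mem_dartsAt] at hx
        apply hv
        rw [rootVertex, ← ho, vert_rot, hx]
      have := idx_lt_idx_rot h e1 e2
      omega
    omega

/-- The map has one edge more than vertices. -/
def HasTorusEdges [Fintype V] [Fintype D] (T : StemMap V D) : Prop :=
  ∑ x, (1 - T.stemInd x) = 2 * (Fintype.card V + 1)

theorem two_mul_sum_outInd [Fintype D] {T : StemMap V D} (h : T.IsUnicellular) :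
    2 * ∑ x, T.outInd x = ∑ x, (1 - T.stemInd x) := by
  have h1 : ∑ x, T.outInd (T.flip x) = ∑ x, T.outInd x := Equiv.sum_comp T.flip T.outInd
  rw [← Finset.sum_congr rfl fun x _ => outInd_add_flip h x, Finset.sum_add_distrib, h1]
  ring

theorem sum_excess [Fintype V] [Fintype D] {T : StemMap V D} (h : T.IsUnicellular)
    (hE : T.HasTorusEdges) : ∑ v, T.excess v = 2 := by
  classical
  have h1 := two_mul_sum_outInd h
  rw [hE] at h1
  simp only [excess, Finset.sum_add_distrib, Finset.sum_sub_distrib, sum_sum_dartsAt]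
  simp
  linarith

theorem sum_excess_cycle [Fintype D] {T : StemMap V D} (h : T.IsUnicellular) {k : ℕ}
    {c : Fin (k + 1) → D} (hc : T.IsCycle c) :
    ∑ i, T.excess (T.vert (c i)) =
      (T.rightSum c T.outInd + T.inRight c T.root)
      + (T.rightSum (T.reverse c) T.outInd + T.inRight (T.reverse c) T.root) := by
  classical
  have h1 := rightSum_add_leftSum hc T.outInd
  have h2 : ∑ i, (T.outInd (c i) + T.outInd (T.flip (c i))) = k + 1 := by
    rw [Finset.sum_congr rfl fun i _ => by
      rw [outInd_add_flip h, stemInd_of_not (not_isStem_of_isCycle hc i)]]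
    simp
  have h3 : ∑ i, (if T.vert (c i) = T.rootVertex then (1 : ℤ) else 0)
      = T.inRight c T.root + T.inRight (T.reverse c) T.root := by
    by_cases hy : ∃ i, T.vert (c i) = T.vert T.root
    · rw [inRight_add_inRight_reverse hc hy]
      obtain ⟨i, hi⟩ := hy
      rw [Finset.sum_eq_single i]
      · simp [rootVertex, hi]
      · intro j _ hj
        exact if_neg fun h => hj (hc.injective (h.trans hi.symm))
      · simp
    · push Not at hy
      rw [inRight_add_inRight_reverse_of_forall_ne hc hy]
      exact Finset.sum_eq_zero fun i _ => if_neg (hy i)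
  rw [rightSum_reverse]
  simp only [excess, Finset.sum_add_distrib, Finset.sum_sub_distrib, h3, ← h1, h2]
  simp
  ring

theorem sum_excess_cycle_le [Fintype V] [Fintype D] {T : StemMap V D} (h : T.IsUnicellular)
    (hE : T.HasTorusEdges) {k : ℕ} {c : Fin (k + 1) → D} (hc : T.IsCycle c) :
    ∑ i, T.excess (T.vert (c i)) ≤ 2 := by
  classical
  rw [← sum_excess h hE, ← Finset.sum_image (g := fun i => T.vert (c i)) (f := T.excess)
    (fun i _ j _ hij => hc.injective hij)]
  exact Finset.sum_le_sum_of_subset_of_nonneg (Finset.subset_univ _)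
    fun v _ _ => excess_nonneg h v

/-- Each side of each cycle is met in the order of the tour of the face, up to a single turn. -/
theorem rightSum_outInd [Fintype V] [Fintype D] {T : StemMap V D} (h : T.IsUnicellular)
    (hE : T.HasTorusEdges) {k : ℕ} {c : Fin (k + 1) → D} (hc : T.IsCycle c) :
    T.rightSum c T.outInd = 1 - T.inRight c T.root := by
  have h1 := one_le_rightSum_outInd_add h hc
  have h2 := one_le_rightSum_outInd_add h (isCycle_reverse hc)
  have h3 := sum_excess_cycle h hc
  have h4 := sum_excess_cycle_le h hE hc
  linarith

/-- Vertices of positive excess are on all cycles, because the two sides of a cycle exhaust the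
total excess. -/
theorem isSpecial_of_excess_pos [Fintype V] [Fintype D] {T : StemMap V D} (h : T.IsUnicellular)
    (hE : T.HasTorusEdges) {v : V} (hv : 0 < T.excess v) : T.IsSpecial v := by
  classical
  intro k c hc
  by_contra hne
  push Not at hne
  have h1 := one_le_rightSum_outInd_add h hc
  have h2 := one_le_rightSum_outInd_add h (isCycle_reverse hc)
  have h3 := sum_excess_cycle h hc
  have h4 := sum_excess h hE
  rw [← Finset.sum_image (g := fun i => T.vert (c i)) (f := T.excess)
    (fun i _ j _ hij => hc.injective hij)] at h3
  have h5 : v ∉ Finset.univ.image fun i => T.vert (c i) := by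
    simpa using hne
  have h6 := Finset.sum_le_sum_of_subset_of_nonneg (f := T.excess)
    (Finset.subset_univ (insert v (Finset.univ.image fun i => T.vert (c i))))
    fun v _ _ => excess_nonneg h v
  rw [Finset.sum_insert h5] at h6
  linarith

/-! ### The flow of label variations -/

/-- The variation of the labels around the half-edge `x`, corrected by the value that it would have
in a plane tree. It is an antisymmetric function on the darts of the edges. -/
def flow (T : StemMap V D) (x : D) : ℤ :=
  T.lab (T.flip x) - T.lab x + 2 * T.outInd x + T.stemInd x - 1

theorem flow_flip [Finite D] {T : StemMap V D} (h : T.IsUnicellular) (x : D) :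
    T.flow (T.flip x) = -T.flow x := by
  have h1 := outInd_add_flip h x
  simp only [flow, T.flip_flip, stemInd_flip]
  linarith

open Classical in
theorem flow_eq [Finite D] {T : StemMap V D} (h : T.IsUnicellular)
    (hl : T.label (Nat.card D) = 0) (x : D) :
    T.flow x = (T.lab (T.rot x) - T.lab x) - 3 * (if T.rot x = T.root then 1 else 0)
      + 2 * T.outInd x - T.stemInd x := by
  have h1 := lab_face h hl (T.flip x)
  rw [← rot_eq_face_flip, step_flip, step_eq] at h1
  rw [h1, flow]
  split_ifs <;> ring

/-- Every vertex has outdegree three. -/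
def HasOutdegreeThree [Fintype D] (T : StemMap V D) : Prop :=
  ∀ v, ∑ x ∈ T.dartsAt v, (T.stemInd x + T.outInd x) = 3

open Classical in
theorem sum_dartsAt_flow [Fintype D] {T : StemMap V D} (h : T.IsUnicellular)
    (hl : T.label (Nat.card D) = 0) (hd : T.HasOutdegreeThree) (v : V) :
    ∑ x ∈ T.dartsAt v, T.flow x = 3 * T.excess v - 6 * if v = T.rootVertex then 1 else 0 := by
  have h1 := T.sum_dartsAt_rot_sub v T.lab
  have h2 := T.sum_dartsAt_rot_eq v T.root
  have h3 := hd v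
  have h4 : (if T.vert T.root = v then (1 : ℤ) else 0) = if v = T.rootVertex then 1 else 0 :=
    if_congr eq_comm rfl rfl
  rw [Finset.sum_add_distrib] at h3
  rw [Finset.sum_congr rfl fun x _ => flow_eq h hl x, Finset.sum_sub_distrib,
    Finset.sum_add_distrib, Finset.sum_sub_distrib, ← Finset.mul_sum, ← Finset.mul_sum, h1, h2, h4,
    excess]
  linarith

theorem outBetween_eq [Fintype D] {T : StemMap V D} (h : T.IsUnicellular) (a b : D) :
    (T.outBetween a b : ℤ) = ∑ x ∈ T.arc a b, (T.stemInd x + T.outInd x) := by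
  classical
  have h1 : ∀ x, T.stemInd x + T.outInd x = if T.IsOut x then 1 else 0 := by
    intro x
    rw [isOut_iff h]
    by_cases h2 : T.OutEdge x
    · simp [stemInd, outInd, h2, not_isStem_of_outEdge h2]
    · simp [stemInd, outInd, h2]
  simp_rw [h1]
  rw [Finset.sum_boole, outBetween, Set.ncard_eq_toFinset_card']
  congr 2
  ext x
  simp [mem_arc]

theorem gamma_eq [Fintype D] {T : StemMap V D} (h : T.IsUnicellular) {k : ℕ}
    (c : Fin (k + 1) → D) :
    T.gamma c = T.rightSum c (fun x => T.stemInd x + T.outInd x)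
      - T.leftSum c (fun x => T.stemInd x + T.outInd x) := by
  simp only [gamma, outBetween_eq h, Finset.sum_sub_distrib, rightSum, leftSum]

/-- In the balanced case, the flow entering the right side of a cycle is `3`, up to the
contribution of the root. -/
theorem rightSum_flow [Fintype V] [Fintype D] {T : StemMap V D} (h : T.IsUnicellular)
    (hE : T.HasTorusEdges) (hl : T.label (Nat.card D) = 0) (hd : T.HasOutdegreeThree)
    (hb : T.IsBalanced) {k : ℕ} {c : Fin (k + 1) → D} (hc : T.IsCycle c) :
    T.rightSum c T.flow = 3 - 6 * T.inRight c T.root := by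
  classical
  have h1 := hb k c hc
  rw [gamma_eq h] at h1
  have h2 := rightSum_add_leftSum hc fun x => T.stemInd x + T.outInd x
  rw [Finset.sum_congr rfl fun i _ => hd (T.vert (c i))] at h2
  have h3 : ∑ i, (T.stemInd (c i) + T.outInd (c i)
      + (T.stemInd (T.flip (c i)) + T.outInd (T.flip (c i)))) = k + 1 := by
    have : ∀ i, (T.stemInd (c i) + T.outInd (c i)
      + (T.stemInd (T.flip (c i)) + T.outInd (T.flip (c i)))) = 1 := by
      intro i
      have := outInd_add_flip h (c i)
      rw [stemInd_flip, stemInd_of_not (not_isStem_of_isCycle hc i)] at *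
      linarith
    simp [this]
  rw [h3] at h2
  have h4 : T.rightSum c (fun x => T.stemInd x + T.outInd x) = k + 1 := by
    simp at h2
    linarith
  rw [rightSum_add] at h4
  have h5 := rightSum_outInd h hE hc
  have h6 := rightSum_rot_sub hc T.lab
  have h7 : ∑ i, (T.lab (c i) - T.lab (T.face (c i)))
      = (k + 1) - 3 * ∑ i, if T.face (c i) = T.root then (1 : ℤ) else 0 := by
    have : ∀ i, T.lab (c i) - T.lab (T.face (c i))
        = 1 - 3 * if T.face (c i) = T.root then (1 : ℤ) else 0 := by
      intro i
      rw [lab_face h hl, step_eq, stemInd_of_not (not_isStem_of_isCycle hc i)]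
      split_ifs <;> ring
    rw [Finset.sum_congr rfl fun i _ => this i, Finset.sum_sub_distrib, ← Finset.mul_sum]
    simp
  have h8 : T.rightSum c T.flow = T.rightSum c (fun x => T.lab (T.rot x) - T.lab x)
      - 3 * T.rightSum c (fun x => if T.rot x = T.root then 1 else 0)
      + 2 * T.rightSum c T.outInd - T.rightSum c T.stemInd := by
    rw [← rightSum_const_mul, ← rightSum_const_mul, ← rightSum_sub, ← rightSum_add,
      ← rightSum_sub]
    exact congrArg _ (funext fun x => flow_eq h hl x)
  rw [h6, h7] at h8
  have h9 : T.inRight c T.root = T.rightSum c (fun x => if T.rot x = T.root then 1 else 0)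
    + ∑ i, if T.face (c i) = T.root then 1 else 0 := rfl
  linarith

/-! ### Unit flows along the tour of the face -/

open Classical in
/-- The unit flow from the root vertex to the vertex of the angle `t` carried by the part of the
tour of the face that precedes `t`, edges walked along in both directions being cancelled. -/
def tourFlow (T : StemMap V D) (t x : D) : ℤ :=
  (if T.idx t ≤ T.idx x then 1 else 0) - if T.idx t ≤ T.idx (T.flip x) then 1 else 0

theorem tourFlow_flip (T : StemMap V D) (t x : D) : T.tourFlow t (T.flip x) = -T.tourFlow t x := by
  simp [tourFlow, T.flip_flip]

open Classical in
theorem idx_le_face [Finite D] {T : StemMap V D} (h : T.IsUnicellular) (t x : D) :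
    (if T.idx t ≤ T.idx (T.face x) then (1 : ℤ) else 0) = (if T.idx t ≤ T.idx x then 1 else 0)
      + (if T.face x = t then 1 else 0) - if T.face x = T.root then 1 else 0 := by
  have hinj := idx_injective h
  have ht := idx_lt h t
  by_cases hr : T.face x = T.root
  · have h1 := idx_of_face_eq_root h hr
    have h2 : T.idx t ≤ T.idx x := by omega
    by_cases h3 : T.root = t
    · simp [hr, h3, h2]
    · have : T.idx t ≠ 0 := fun h0 => h3 (hinj ((idx_root h).trans h0.symm))
      simp [hr, h3, h2, idx_root h, this]
  · have h1 := idx_face_of_ne h hr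
    by_cases h3 : T.face x = t
    · rw [h3] at h1
      have : ¬ T.idx t ≤ T.idx x := by omega
      rw [h3] at hr
      simp [h3, hr, this]
    · have : T.idx (T.face x) ≠ T.idx t := fun h0 => h3 (hinj h0)
      have h4 : (T.idx t ≤ T.idx (T.face x)) ↔ T.idx t ≤ T.idx x := by omega
      simp [h3, hr, h4]

open Classical in
theorem tourFlow_eq [Finite D] {T : StemMap V D} (h : T.IsUnicellular) (t x : D) :
    T.tourFlow t x = (if T.rot x = t then 1 else 0) - (if T.rot x = T.root then 1 else 0)
      - ((if T.idx t ≤ T.idx (T.rot x) then 1 else 0) - if T.idx t ≤ T.idx x then 1 else 0) := by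
  have := idx_le_face h t (T.flip x)
  rw [← rot_eq_face_flip] at this
  rw [this, tourFlow]
  ring

open Classical in
theorem sum_dartsAt_tourFlow [Fintype D] {T : StemMap V D} (h : T.IsUnicellular) (t : D) (v : V) :
    ∑ x ∈ T.dartsAt v, T.tourFlow t x
      = (if T.vert t = v then 1 else 0) - if v = T.rootVertex then 1 else 0 := by
  have h1 := T.sum_dartsAt_rot_sub v fun x => if T.idx t ≤ T.idx x then 1 else 0
  have h4 : (if T.vert T.root = v then (1 : ℤ) else 0) = if v = T.rootVertex then 1 else 0 :=
    if_congr eq_comm rfl rfl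
  rw [Finset.sum_congr rfl fun x _ => tourFlow_eq h t x, Finset.sum_sub_distrib,
    Finset.sum_sub_distrib, sum_dartsAt_rot_eq, sum_dartsAt_rot_eq, h4, h1, sub_zero]

theorem rightSum_tourFlow [Fintype D] {T : StemMap V D} (h : T.IsUnicellular) {k : ℕ}
    {c : Fin (k + 1) → D} (hc : T.IsCycle c) (t : D) :
    T.rightSum c (T.tourFlow t) = T.inRight c t - T.inRight c T.root := by
  classical
  have h1 := rightSum_rot_sub hc fun x => if T.idx t ≤ T.idx x then 1 else 0
  have h2 : T.rightSum c (T.tourFlow t) = T.rightSum c (fun x => if T.rot x = t then 1 else 0)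
      - T.rightSum c (fun x => if T.rot x = T.root then 1 else 0)
      - T.rightSum c (fun x => (if T.idx t ≤ T.idx (T.rot x) then 1 else 0)
        - if T.idx t ≤ T.idx x then 1 else 0) := by
    rw [← rightSum_sub, ← rightSum_sub]
    exact congrArg _ (funext fun x => tourFlow_eq h t x)
  rw [h2, h1, Finset.sum_congr rfl fun i _ => by rw [idx_le_face h t (c i)],
    Finset.sum_sub_distrib, Finset.sum_sub_distrib, Finset.sum_add_distrib]
  unfold inRight
  ring

/-! ### Circulations -/

open Classical in
/-- The indicator function of a set of darts. -/
def memInd (X : Finset D) (x : D) : ℤ := if x ∈ X then 1 else 0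

theorem memInd_of_mem {X : Finset D} {x : D} (hx : x ∈ X) : memInd X x = 1 := by
  simp [memInd, hx]

theorem memInd_of_notMem {X : Finset D} {x : D} (hx : x ∉ X) : memInd X x = 0 := by
  simp [memInd, hx]

theorem memInd_nonneg (X : Finset D) (x : D) : 0 ≤ memInd X x := by
  unfold memInd; split_ifs <;> norm_num

theorem sum_memInd_mul [Fintype D] {R : Type*} [CommRing R] (X : Finset D) (g : D → R) :
    ∑ x, (memInd X x : R) * g x = ∑ x ∈ X, g x := by
  classical
  have : ∀ x, (memInd X x : R) * g x = if x ∈ X then g x else 0 := by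
    intro x
    by_cases hx : x ∈ X
    · simp [memInd_of_mem hx, hx]
    · simp [memInd_of_notMem hx, hx]
  simp [this]

/-- A set of half-edges, with at most one half of each edge, such that every vertex is left as often
as it is entered when each of these half-edges is walked along. -/
structure IsCirculation [Fintype D] (T : StemMap V D) (X : Finset D) : Prop where
  flip_notMem : ∀ x ∈ X, T.flip x ∉ X
  balance : ∀ v, ∑ x ∈ T.dartsAt v, (memInd X x - memInd X (T.flip x)) = 0

theorem IsCirculation.exists_next [Fintype D] {T : StemMap V D} {X : Finset D}
    (hX : T.IsCirculation X) {x : D} (hx : x ∈ X) : ∃ y ∈ X, T.vert y = T.vert (T.flip x) := by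
  classical
  by_contra hne
  push Not at hne
  have h1 := hX.balance (T.vert (T.flip x))
  have h2 : ∑ y ∈ T.dartsAt (T.vert (T.flip x)),
      (memInd X y - memInd X (T.flip y)) < 0 := by
    refine Finset.sum_neg' (fun y hy => ?_) ⟨T.flip x, mem_dartsAt.2 rfl, ?_⟩
    · have : y ∉ X := fun h => hne y h (mem_dartsAt.1 hy)
      rw [memInd_of_notMem this]
      linarith [memInd_nonneg X (T.flip y)]
    · rw [memInd_of_notMem (hX.flip_notMem x hx), T.flip_flip, memInd_of_mem hx]
      norm_num
  omega

/-- A nonempty circulation contains a cycle: follow its half-edges until a vertex is repeated. -/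
theorem IsCirculation.exists_isCycle [Finite V] [Fintype D] {T : StemMap V D} {X : Finset D}
    (hX : T.IsCirculation X) (hne : X.Nonempty) :
    ∃ (k : ℕ) (c : Fin (k + 1) → D), T.IsCycle c ∧ ∀ i, c i ∈ X := by
  classical
  choose! nxt hnxt using fun x (hx : x ∈ X) => hX.exists_next hx
  obtain ⟨x₀, hx₀⟩ := hne
  set u : ℕ → D := fun m => nxt^[m] x₀ with hu
  have huX : ∀ m, u m ∈ X := by
    intro m
    induction m with
    | zero => exact hx₀
    | succ m ih =>
      simp only [hu, Function.iterate_succ_apply'] at ih ⊢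
      exact (hnxt _ ih).1
  have huv : ∀ m, T.vert (u (m + 1)) = T.vert (T.flip (u m)) := by
    intro m
    have := (hnxt _ (huX m)).2
    simpa only [hu, Function.iterate_succ_apply'] using this
  -- the shortest time between two visits of a vertex gives a cycle
  have hrep : ∃ g, ∃ m, T.vert (u m) = T.vert (u (m + (g + 1))) := by
    obtain ⟨a, b, hab, h⟩ := Finite.exists_ne_map_eq_of_infinite fun m => T.vert (u m)
    rcases lt_or_gt_of_ne hab with h1 | h1
    · exact ⟨b - a - 1, a, by rw [show a + (b - a - 1 + 1) = b by omega]; exact h⟩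
    · exact ⟨a - b - 1, b, by rw [show b + (a - b - 1 + 1) = a by omega]; exact h.symm⟩
  obtain ⟨m, hm⟩ := Nat.find_spec hrep
  set g := Nat.find hrep with hg
  have hmin : ∀ g' < g, ∀ m, T.vert (u m) ≠ T.vert (u (m + (g' + 1))) := by
    intro g' hg' m' h
    exact Nat.find_min hrep hg' ⟨m', h⟩
  refine ⟨g, fun i => u (m + i), ⟨?_, ?_, ?_⟩, fun i => huX _⟩
  · intro i
    rw [← huv]
    rcases Nat.lt_or_ge (i : ℕ) g with h | h
    · rw [Fin.val_add_one_of_lt (by rw [Fin.lt_def]; simpa using h), add_assoc]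
    · have h1 : i = Fin.last g := Fin.ext (by have := i.2; simp; omega)
      rw [h1]
      simpa [add_assoc] using hm.symm
  · have key : ∀ i j : Fin (g + 1), i < j → T.vert (u (m + i)) ≠ T.vert (u (m + j)) := by
      intro i j hij h
      rw [Fin.lt_def] at hij
      have hj := j.2
      refine hmin ((j : ℕ) - i - 1) (by omega) (m + i) ?_
      rw [h]
      congr 2
      omega
    intro i j hij
    rcases lt_trichotomy i j with h | h | h
    · exact absurd hij (key i j h)
    · exact h
    · exact absurd hij.symm (key j i h)
  · intro i j h
    have := hX.flip_notMem _ (huX (m + i))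
    rw [h] at this
    exact this (huX _)

theorem memInd_image {k : ℕ} [DecidableEq D] {c : Fin (k + 1) → D}
    (hc : Function.Injective c) (y : D) :
    memInd (Finset.univ.image c) y = ∑ i, if c i = y then 1 else 0 := by
  by_cases h : y ∈ Finset.univ.image c
  · rw [memInd_of_mem h]
    obtain ⟨i, -, rfl⟩ := Finset.mem_image.1 h
    rw [Finset.sum_eq_single i]
    · simp
    · intro j _ hj
      exact if_neg fun h => hj (hc h)
    · simp
  · rw [memInd_of_notMem h, Finset.sum_eq_zero]
    intro i _
    exact if_neg fun h1 => h (Finset.mem_image.2 ⟨i, Finset.mem_univ _, h1⟩)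

theorem IsCycle.injective' {T : StemMap V D} {k : ℕ} {c : Fin (k + 1) → D} (hc : T.IsCycle c) :
    Function.Injective c := fun _ _ h => hc.injective (congrArg T.vert h)

theorem isCirculation_image [Fintype D] [DecidableEq D] {T : StemMap V D} {k : ℕ}
    {c : Fin (k + 1) → D} (hc : T.IsCycle c) : T.IsCirculation (Finset.univ.image c) where
  flip_notMem x hx := by
    obtain ⟨i, -, rfl⟩ := Finset.mem_image.1 hx
    intro h
    obtain ⟨j, -, hj⟩ := Finset.mem_image.1 h
    exact hc.flip_ne i j hj.symm
  balance v := by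
    classical
    have h1 : ∀ y, memInd (Finset.univ.image c) (T.flip y)
        = ∑ i, if T.flip (c i) = y then 1 else 0 := by
      intro y
      rw [memInd_image hc.injective']
      refine Finset.sum_congr rfl fun i _ => if_congr ?_ rfl rfl
      constructor
      · intro h; rw [h, T.flip_flip]
      · intro h; rw [← h, T.flip_flip]
    have h2 : ∀ y, memInd (Finset.univ.image c) y = ∑ i, if c (i + 1) = y then 1 else 0 := by
      intro y
      rw [memInd_image hc.injective', sum_fin_succ fun i => if c i = y then (1 : ℤ) else 0]
    rw [Finset.sum_sub_distrib, sub_eq_zero]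
    simp_rw [h1, h2]
    rw [Finset.sum_comm, Finset.sum_comm (s := T.dartsAt v)]
    refine Finset.sum_congr rfl fun i _ => ?_
    simp [mem_dartsAt, hc.vert_flip]

theorem IsCirculation.sdiff [Fintype D] [DecidableEq D] {T : StemMap V D} {X Y : Finset D}
    (hX : T.IsCirculation X) (hY : T.IsCirculation Y) (hYX : Y ⊆ X) : T.IsCirculation (X \ Y) where
  flip_notMem x hx h :=
    hX.flip_notMem x (Finset.mem_sdiff.1 hx).1 (Finset.mem_sdiff.1 h).1
  balance v := by
    have h3 : ∀ x, memInd (X \ Y) x = memInd X x - memInd Y x := by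
      intro x
      by_cases hy : x ∈ Y
      · simp [memInd, hy, hYX hy]
      · simp [memInd, hy]
    refine Eq.trans ?_ (sub_eq_zero.2 ((hX.balance v).trans (hY.balance v).symm))
    rw [← Finset.sum_sub_distrib]
    refine Finset.sum_congr rfl fun x _ => ?_
    rw [h3, h3]
    ring

/-- The increments of a function of the vertices sum to zero over a circulation. -/
theorem IsCirculation.sum_sub_eq_zero [Fintype V] [Fintype D] {T : StemMap V D} {X : Finset D}
    (hX : T.IsCirculation X) (p : V → ℚ) :
    ∑ x ∈ X, (p (T.vert (T.flip x)) - p (T.vert x)) = 0 := by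
  have h2 : ∑ x, (memInd X x : ℚ) * p (T.vert (T.flip x))
      = ∑ x, (memInd X (T.flip x) : ℚ) * p (T.vert x) := by
    rw [← Equiv.sum_comp T.flip]
    simp [T.flip_flip]
  have h3 : ∑ x, ((memInd X x - memInd X (T.flip x) : ℤ) : ℚ) * p (T.vert x) = 0 := by
    rw [← T.sum_sum_dartsAt]
    refine Finset.sum_eq_zero fun v _ => ?_
    rw [Finset.sum_congr rfl fun x hx => by rw [mem_dartsAt.1 hx], ← Finset.sum_mul,
      ← Int.cast_sum, hX.balance v, Int.cast_zero, zero_mul]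
  rw [← sum_memInd_mul]
  simp only [mul_sub, Finset.sum_sub_distrib, h2]
  simp only [Int.cast_sub, sub_mul, Finset.sum_sub_distrib] at h3
  linarith

/-! ### Chords of the tour and their crossings -/

open Classical in
/-- The half-edges met strictly between `d` and `flip d` in the tour of the face, whose other
halves are not. -/
def crossing [Fintype D] (T : StemMap V D) (d : D) : Finset D :=
  Finset.univ.filter fun x => (T.idx d < T.idx x ∧ T.idx x < T.idx (T.flip d)) ∧
    ¬ (T.idx d < T.idx (T.flip x) ∧ T.idx (T.flip x) < T.idx (T.flip d))

theorem mem_crossing [Fintype D] {T : StemMap V D} {d x : D} : x ∈ T.crossing d ↔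
    (T.idx d < T.idx x ∧ T.idx x < T.idx (T.flip d)) ∧
    ¬ (T.idx d < T.idx (T.flip x) ∧ T.idx (T.flip x) < T.idx (T.flip d)) := by
  simp [crossing]

open Classical in
theorem idx_mem_Ioc_rot [Finite D] {T : StemMap V D} (h : T.IsUnicellular) {d : D}
    (hd : T.idx d < T.idx (T.flip d)) (x : D) :
    (if T.idx d < T.idx (T.rot x) ∧ T.idx (T.rot x) ≤ T.idx (T.flip d) then (1 : ℤ) else 0)
      = (if T.idx d < T.idx (T.flip x) ∧ T.idx (T.flip x) < T.idx (T.flip d) then 1 else 0)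
        + if x = T.flip d then 1 else 0 := by
  have hinj := idx_injective h
  have hxd : x = T.flip d ↔ T.idx (T.flip x) = T.idx d :=
    ⟨fun h => by rw [h, T.flip_flip], fun h => by rw [← hinj h, T.flip_flip]⟩
  rw [rot_eq_face_flip]
  have hlt := idx_lt h (T.flip d)
  by_cases hr : T.face (T.flip x) = T.root
  · have h1 := idx_of_face_eq_root h hr
    rw [hr, idx_root h, if_neg (by omega), if_neg (by omega), if_neg (by rw [hxd]; omega)]
    rfl
  · have h1 := idx_face_of_ne h hr
    rw [h1]
    by_cases h2 : x = T.flip d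
    · rw [if_pos h2]
      rw [hxd] at h2
      rw [if_pos (by omega), if_neg (by omega)]
      rfl
    · rw [if_neg h2, add_zero]
      rw [hxd] at h2
      exact if_congr (by omega) rfl rfl

/-- The half-edges crossing a given one form a circulation: the part of the tour of the face between
the two halves of an edge is a closed walk, and these half-edges are what remains of it when the
edges walked along in both directions are cancelled. -/
theorem isCirculation_crossing [Fintype D] {T : StemMap V D} (h : T.IsUnicellular) {d : D}
    (hd : T.idx d < T.idx (T.flip d)) : T.IsCirculation (T.crossing d) where
  flip_notMem x hx h1 := by
    rw [mem_crossing] at hx h1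
    exact hx.2 h1.1
  balance v := by
    classical
    have h1 := T.sum_dartsAt_rot_sub v fun x =>
      if T.idx d < T.idx x ∧ T.idx x ≤ T.idx (T.flip d) then (1 : ℤ) else 0
    rw [← neg_eq_zero, ← Finset.sum_neg_distrib] at h1
    refine Eq.trans ?_ h1
    refine Finset.sum_congr rfl fun x _ => ?_
    rw [idx_mem_Ioc_rot h hd]
    have h2 : (if T.idx d < T.idx x ∧ T.idx x ≤ T.idx (T.flip d) then (1 : ℤ) else 0)
        = (if T.idx d < T.idx x ∧ T.idx x < T.idx (T.flip d) then 1 else 0)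
          + if x = T.flip d then 1 else 0 := by
      have hinj := idx_injective h
      by_cases h2 : x = T.flip d
      · simp [h2, hd]
      · have : T.idx x ≠ T.idx (T.flip d) := fun h3 => h2 (hinj h3)
        rw [if_neg h2, add_zero]
        exact if_congr (by omega) rfl rfl
    rw [h2]
    unfold memInd
    simp only [mem_crossing, T.flip_flip]
    by_cases ha : T.idx d < T.idx x ∧ T.idx x < T.idx (T.flip d) <;>
    by_cases hb : T.idx d < T.idx (T.flip x) ∧ T.idx (T.flip x) < T.idx (T.flip d) <;>
    simp [ha, hb]

/-- If no half-edge crosses `d`, the part of the tour between the two halves of `d` contains both of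
two consecutive angles of a vertex or none of them. -/
theorem idx_mem_Ioc_rot_iff [Fintype D] {T : StemMap V D} (h : T.IsUnicellular) {d : D}
    (hd : T.idx d < T.idx (T.flip d)) (hX : T.crossing d = ∅) (x : D) :
    (T.idx d < T.idx (T.rot x) ∧ T.idx (T.rot x) ≤ T.idx (T.flip d)) ↔
      (T.idx d < T.idx x ∧ T.idx x ≤ T.idx (T.flip d)) := by
  classical
  have hinj := idx_injective h
  have h1 := idx_mem_Ioc_rot h hd x
  have h2 : x ∉ T.crossing d := by simp [hX]
  have h3 : T.flip x ∉ T.crossing d := by simp [hX]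
  rw [mem_crossing] at h2 h3
  rw [T.flip_flip] at h3
  by_cases hx : x = T.flip d
  · subst hx
    rw [T.flip_flip] at h1
    simp only [lt_self_iff_false, false_and, if_false, if_true, zero_add] at h1
    constructor
    · exact fun _ => ⟨hd, le_rfl⟩
    · intro _
      by_contra hc
      rw [if_neg hc] at h1
      norm_num at h1
  · have h4 : T.idx x ≠ T.idx (T.flip d) := fun h5 => hx (hinj h5)
    rw [if_neg hx, add_zero] at h1
    have h5 : (T.idx d < T.idx (T.rot x) ∧ T.idx (T.rot x) ≤ T.idx (T.flip d)) ↔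
        (T.idx d < T.idx (T.flip x) ∧ T.idx (T.flip x) < T.idx (T.flip d)) := by
      split_ifs at h1 with ha hb hb
      · tauto
      · norm_num at h1
      · norm_num at h1
      · tauto
    rw [h5]
    constructor
    · intro h6
      have : T.idx d < T.idx x ∧ T.idx x < T.idx (T.flip d) := by
        by_contra hc
        exact h3 ⟨h6, hc⟩
      exact ⟨this.1, this.2.le⟩
    · intro h6
      by_contra hc
      exact h2 ⟨⟨h6.1, by omega⟩, hc⟩

/-- If no half-edge crosses `d`, the part of the tour between the two halves of `d` contains all
the angles of a vertex or none of them. -/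
theorem idx_mem_Ioc_iff_of_vert_eq [Fintype D] {T : StemMap V D} (h : T.IsUnicellular) {d : D}
    (hd : T.idx d < T.idx (T.flip d)) (hX : T.crossing d = ∅) {x y : D}
    (hxy : T.vert x = T.vert y) :
    (T.idx d < T.idx y ∧ T.idx y ≤ T.idx (T.flip d)) ↔
      (T.idx d < T.idx x ∧ T.idx x ≤ T.idx (T.flip d)) := by
  obtain ⟨k, rfl⟩ := ((T.vert_eq_iff x y).1 hxy).exists_nat_pow_eq
  clear hxy
  induction k with
  | zero => simp
  | succ k ih => rw [pow_succ', Equiv.Perm.mul_apply, idx_mem_Ioc_rot_iff h hd hX, ih]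

/-- If no half-edge crosses the edge of the outgoing half-edge `x`, then `x` is the last half-edge
of its vertex that is met in the tour, and the root angle is at another vertex. -/
theorem idx_le_of_outEdge [Fintype D] {T : StemMap V D} (h : T.IsUnicellular) {x y : D}
    (hx : T.OutEdge x) (hX : T.crossing (T.flip x) = ∅) (hxy : T.vert x = T.vert y) :
    T.idx (T.flip x) < T.idx y ∧ T.idx y ≤ T.idx x := by
  have := idx_mem_Ioc_iff_of_vert_eq h (d := T.flip x) (by rw [T.flip_flip]; exact hx) hX hxy
  rw [T.flip_flip] at this
  exact this.2 ⟨hx, le_rfl⟩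

/-- The edges of a cycle are crossed. -/
theorem crossing_nonempty_of_isCycle [Fintype D] {T : StemMap V D} (h : T.IsUnicellular) {d : D}
    (hd : T.idx d < T.idx (T.flip d)) {k : ℕ} {c : Fin (k + 1) → D} (hc : T.IsCycle c)
    {i : Fin (k + 1)} (hi : c i = d ∨ c i = T.flip d) : (T.crossing d).Nonempty := by
  classical
  by_contra hX
  rw [Finset.not_nonempty_iff_eq_empty] at hX
  have hinj := idx_injective h
  set p : D → ℤ := fun x => if T.idx d < T.idx x ∧ T.idx x ≤ T.idx (T.flip d) then 1 else 0
    with hp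
  have hrot : ∀ x, p (T.rot x) = p x := fun x =>
    if_congr (idx_mem_Ioc_rot_iff h hd hX x) rfl rfl
  have h1 := rightSum_rot_sub hc p
  have h2 : T.rightSum c (fun x => p (T.rot x) - p x) = 0 := by
    simp [hrot, rightSum]
  have h3 : ∀ x, p x - p (T.face x) = (if x = T.flip d then 1 else 0) - if x = d then 1 else 0 := by
    intro x
    have e1 : T.face x = T.rot (T.flip x) := rfl
    have e2 := idx_mem_Ioc_rot h hd (T.flip x)
    rw [T.flip_flip] at e2
    have e3 : (T.flip x = T.flip d) ↔ x = d := T.flip.injective.eq_iff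
    rw [if_congr e3 rfl rfl] at e2
    have e4 : p (T.face x) = _ := e2
    rw [e4]
    by_cases h4 : x = T.flip d
    · subst h4
      have : T.flip d ≠ d := fun h => by rw [h] at hd; exact lt_irrefl _ hd
      simp [hp, hd, this]
    · have h5 : T.idx x ≠ T.idx (T.flip d) := fun h6 => h4 (hinj h6)
      have h6 : (T.idx d < T.idx x ∧ T.idx x ≤ T.idx (T.flip d)) ↔
        (T.idx d < T.idx x ∧ T.idx x < T.idx (T.flip d)) := by omega
      simp only [hp, h6, h4, if_false]
      ring
  have hcount : ∀ y, (∑ j, if c j = y then (1 : ℤ) else 0)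
      = memInd (Finset.univ.image c) y := fun y => (memInd_image hc.injective' y).symm
  rw [h2, Finset.sum_congr rfl fun i _ => h3 (c i), Finset.sum_sub_distrib, hcount, hcount] at h1
  have hcirc := isCirculation_image hc
  have hmem : c i ∈ Finset.univ.image c := Finset.mem_image_of_mem _ (Finset.mem_univ _)
  rcases hi with hi | hi
  · rw [hi] at hmem
    rw [memInd_of_mem hmem, memInd_of_notMem (hcirc.flip_notMem _ hmem)] at h1
    norm_num at h1
  · rw [hi] at hmem
    have := hcirc.flip_notMem _ hmem
    rw [T.flip_flip] at this
    rw [memInd_of_mem hmem, memInd_of_notMem this] at h1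
    norm_num at h1

/-! ### Special vertices -/

theorem outEdge_or_lt [Finite D] {T : StemMap V D} (h : T.IsUnicellular) {x : D}
    (hx : ¬ T.IsStem x) : T.OutEdge x ∨ T.idx x < T.idx (T.flip x) :=
  lt_or_gt_of_ne (idx_flip_ne h hx)

theorem IsCirculation.not_isStem [Fintype D] {T : StemMap V D} {X : Finset D}
    (hX : T.IsCirculation X) {x : D} (hx : x ∈ X) : ¬ T.IsStem x := by
  intro hs
  have h1 := hX.flip_notMem x hx
  rw [show T.flip x = x from hs] at h1
  exact h1 hx

theorem sum_outInd_le_one [Fintype D] {T : StemMap V D} {v : V}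
    (hv : ∀ x y, T.vert x = v → T.vert y = v → T.OutEdge x → T.OutEdge y → x = y) :
    ∑ x ∈ T.dartsAt v, T.outInd x ≤ 1 := by
  classical
  unfold outInd
  rw [Finset.sum_boole]
  norm_cast
  rw [Finset.card_le_one]
  intro x hx y hy
  rw [Finset.mem_filter, mem_dartsAt] at hx hy
  exact hv x y hx.1 hy.1 hx.2 hy.2

/-- A vertex of excess zero meets the part of the tour between the two halves of one of its
half-edges only if that half-edge is outgoing. -/
theorem not_idx_mem_Ioc_of_excess_eq_zero [Fintype D] {T : StemMap V D} (h : T.IsUnicellular)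
    {d y : D} (hv : T.excess (T.vert d) = 0) (hd : T.idx d < T.idx (T.flip d))
    (hy : T.vert y = T.vert d) : ¬ (T.idx d < T.idx y ∧ T.idx y ≤ T.idx (T.flip d)) := by
  classical
  intro hmem
  have h1 := sum_dartsAt_tourFlow h y (T.vert d)
  rw [if_pos hy] at h1
  have h2 : ∀ x, T.tourFlow y x ≤ T.outInd x := by
    intro x
    unfold tourFlow outInd OutEdge
    split_ifs <;> omega
  have h3 : T.tourFlow y d < T.outInd d := by
    unfold tourFlow outInd OutEdge
    rw [if_neg (by omega), if_pos hmem.2, if_neg (by omega)]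
    norm_num
  have h4 : ∑ x ∈ T.dartsAt (T.vert d), T.tourFlow y x < ∑ x ∈ T.dartsAt (T.vert d), T.outInd x :=
    Finset.sum_lt_sum (fun x _ => h2 x) ⟨d, mem_dartsAt.2 rfl, h3⟩
  unfold excess at hv
  linarith

/-- The special vertices are those of positive excess. -/
theorem isSpecial_iff [Fintype V] [Fintype D] {T : StemMap V D} (h : T.IsUnicellular)
    (hE : T.HasTorusEdges) (v : V) : T.IsSpecial v ↔ 0 < T.excess v := by
  classical
  refine ⟨fun hs => ?_, isSpecial_of_excess_pos h hE⟩
  by_contra hle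
  have hv : T.excess v = 0 := le_antisymm (not_lt.1 hle) (excess_nonneg h v)
  by_cases hcyc : ∃ (k : ℕ) (c : Fin (k + 1) → D), T.IsCycle c
  · obtain ⟨k, c, hc⟩ := hcyc
    obtain ⟨i, hi⟩ := hs k c hc
    -- one of the two half-edges of the cycle at `v` is incoming
    obtain ⟨d, hdv, hd, hdX⟩ : ∃ d, T.vert d = v ∧ T.idx d < T.idx (T.flip d) ∧
        (T.crossing d).Nonempty := by
      by_cases h1 : T.OutEdge (c i)
      · have hw : T.vert (T.flip (c (i - 1))) = v := by
          rw [hc.vert_flip, sub_add_cancel, hi]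
        rcases outEdge_or_lt h (x := T.flip (c (i - 1)))
          (by rw [isStem_flip]; exact not_isStem_of_isCycle hc _) with h2 | h2
        · exfalso
          have h3 : T.outInd (c i) + T.outInd (T.flip (c (i - 1)))
              ≤ ∑ x ∈ T.dartsAt v, T.outInd x := by
            rw [← Finset.sum_pair (f := T.outInd) (hc.flip_ne (i - 1) i).symm]
            refine Finset.sum_le_sum_of_subset_of_nonneg ?_ fun x _ _ => T.outInd_nonneg x
            intro x hx
            rw [Finset.mem_insert, Finset.mem_singleton] at hx
            rw [mem_dartsAt]
            rcases hx with rfl | rfl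
            · exact hi
            · exact hw
          have h4 : T.outInd (c i) = 1 := if_pos h1
          have h5 : T.outInd (T.flip (c (i - 1))) = 1 := if_pos h2
          unfold excess at hv
          split_ifs at hv <;> linarith
        · exact ⟨_, hw, h2, crossing_nonempty_of_isCycle h h2 hc
            (Or.inr (by rw [T.flip_flip] : c (i - 1) = _))⟩
      · have h2 := (outEdge_or_lt h (not_isStem_of_isCycle hc i)).resolve_left h1
        exact ⟨_, hi, h2, crossing_nonempty_of_isCycle h h2 hc (Or.inl rfl)⟩
    obtain ⟨k', c', hc', hsub⟩ := (isCirculation_crossing h hd).exists_isCycle hdX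
    obtain ⟨l, hl⟩ := hs k' c' hc'
    have h6 := (mem_crossing.1 (hsub l)).1
    subst hdv
    exact not_idx_mem_Ioc_of_excess_eq_zero h hv hd hl ⟨h6.1, h6.2.le⟩
  · -- without cycles there are no crossings, and no vertex has positive excess
    have hX : ∀ d, T.idx d < T.idx (T.flip d) → T.crossing d = ∅ := by
      intro d hd
      by_contra hne
      obtain ⟨k, c, hc, -⟩ := (isCirculation_crossing h hd).exists_isCycle
        (Finset.nonempty_iff_ne_empty.2 hne)
      exact hcyc ⟨k, c, hc⟩
    have hX' : ∀ x, T.OutEdge x → T.crossing (T.flip x) = ∅ := by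
      intro x hx
      exact hX _ (by rw [T.flip_flip]; exact hx)
    have h1 : ∀ w, T.excess w ≤ 0 := by
      intro w
      unfold excess
      split_ifs with hw
      · have : ∑ x ∈ T.dartsAt w, T.outInd x = 0 := by
          refine Finset.sum_eq_zero fun x hx => if_neg fun ho => ?_
          rw [mem_dartsAt] at hx
          have := (idx_le_of_outEdge h ho (hX' x ho) (y := T.root) (hx.trans hw)).1
          rw [idx_root h] at this
          omega
        linarith
      · have := T.sum_outInd_le_one (v := w) fun x y hx hy hox hoy => by
          have e1 := (idx_le_of_outEdge h hox (hX' x hox) (hx.trans hy.symm)).2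
          have e2 := (idx_le_of_outEdge h hoy (hX' y hoy) (hy.trans hx.symm)).2
          exact idx_injective h (le_antisymm e2 e1)
        linarith
    have h2 := sum_excess h hE
    have h3 : ∑ w, T.excess w ≤ 0 := Finset.sum_nonpos fun w _ => h1 w
    linarith

/-! ### Independent circulations -/

theorem exists_out_half [Finite D] {T : StemMap V D} (h : T.IsUnicellular) {x : D}
    (hx : ¬ T.IsStem x) : ∃ y, T.OutEdge y ∧ (y = x ∨ y = T.flip x) := by
  rcases outEdge_or_lt h hx with h1 | h1
  · exact ⟨x, h1, Or.inl rfl⟩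
  · exact ⟨T.flip x, by rw [OutEdge, T.flip_flip]; exact h1, Or.inr rfl⟩

theorem eq_or_eq_flip {T : StemMap V D} {e x y : D} (he : y = e ∨ y = T.flip e)
    (hx : y = x ∨ y = T.flip x) : x = e ∨ x = T.flip e := by
  rcases he with rfl | rfl
  · rcases hx with h | h
    · exact Or.inl h.symm
    · exact Or.inr (by rw [h, T.flip_flip])
  · rcases hx with h | h
    · exact Or.inr h.symm
    · exact Or.inl (T.flip.injective h.symm)

/-- If a function of the vertices has zero increments on the edges of a circulation, except possibly
one, then so it has on that edge. -/
theorem IsCirculation.increment_eq_zero [Fintype V] [Fintype D] {T : StemMap V D} {X : Finset D}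
    (hX : T.IsCirculation X) {e : D} (he : e ∈ X) (p : V → ℚ)
    (hz : ∀ x ∈ X, x ≠ e → p (T.vert (T.flip x)) = p (T.vert x)) {x : D}
    (hx : x = e ∨ x = T.flip e) : p (T.vert (T.flip x)) = p (T.vert x) := by
  have h0 : p (T.vert (T.flip e)) = p (T.vert e) := by
    rw [← sub_eq_zero, ← hX.sum_sub_eq_zero p, Finset.sum_eq_single e]
    · exact fun x hx hxe => sub_eq_zero.2 (hz x hx hxe)
    · exact fun h => absurd he h
  rcases hx with rfl | rfl
  · exact h0
  · rw [T.flip_flip, h0]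

/-- The space of circulations has dimension at most two: there are no three circulations and three
edges such that the incidences form a triangular matrix. Otherwise, a function of the vertices
would be determined by its value at the root and its increments on the other edges, which are
two less than the vertices. -/
theorem not_three_circulations [Fintype V] [Fintype D] {T : StemMap V D} (h : T.IsUnicellular)
    (hE : T.HasTorusEdges) {X₁ X₂ X₃ : Finset D} (hX₁ : T.IsCirculation X₁)
    (hX₂ : T.IsCirculation X₂) (hX₃ : T.IsCirculation X₃) {e₁ e₂ d : D} (h₁₁ : e₁ ∈ X₁)
    (h₁₂ : e₂ ∉ X₁) (h₁₂' : T.flip e₂ ∉ X₁) (h₁₃ : d ∉ X₁) (h₁₃' : T.flip d ∉ X₁)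
    (h₂₁ : e₁ ∉ X₂) (h₂₁' : T.flip e₁ ∉ X₂) (h₂₂ : e₂ ∈ X₂) (h₂₃ : d ∉ X₂) (h₂₃' : T.flip d ∉ X₂)
    (h₃₃ : d ∈ X₃) : False := by
  classical
  obtain ⟨y₁, ho₁, hy₁⟩ := exists_out_half h (hX₁.not_isStem h₁₁)
  obtain ⟨y₂, ho₂, hy₂⟩ := exists_out_half h (hX₂.not_isStem h₂₂)
  obtain ⟨y₃, ho₃, hy₃⟩ := exists_out_half h (hX₃.not_isStem h₃₃)
  set O : Finset D := Finset.univ.filter fun x => T.OutEdge x with hO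
  set B : Finset D := {y₁, y₂, y₃} with hB
  have hff := T.flip_flip
  have hne₁₂ : y₁ ≠ y₂ := by
    rintro rfl
    rcases hy₁ with rfl | rfl <;> rcases hy₂ with h' | h'
    · subst h'; exact h₁₂ h₁₁
    · rw [h'] at h₁₁; exact h₁₂' h₁₁
    · rw [← h'] at h₂₂; exact h₂₁' h₂₂
    · rw [T.flip.injective h'] at h₁₁; exact h₁₂ h₁₁
  have hne₁₃ : y₁ ≠ y₃ := by
    rintro rfl
    rcases hy₁ with rfl | rfl <;> rcases hy₃ with h' | h'
    · subst h'; exact h₁₃ h₁₁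
    · rw [h'] at h₁₁; exact h₁₃' h₁₁
    · rw [← h', hff] at h₁₃'; exact h₁₃' h₁₁
    · rw [T.flip.injective h'] at h₁₁; exact h₁₃ h₁₁
  have hne₂₃ : y₂ ≠ y₃ := by
    rintro rfl
    rcases hy₂ with rfl | rfl <;> rcases hy₃ with h' | h'
    · subst h'; exact h₂₃ h₂₂
    · rw [h'] at h₂₂; exact h₂₃' h₂₂
    · rw [← h', hff] at h₂₃'; exact h₂₃' h₂₂
    · rw [T.flip.injective h'] at h₂₂; exact h₂₃ h₂₂
  have hBcard : B.card = 3 := Finset.card_eq_three.2 ⟨_, _, _, hne₁₂, hne₁₃, hne₂₃, rfl⟩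
  have hBO : B ⊆ O := by
    intro x hx
    simp only [hB, Finset.mem_insert, Finset.mem_singleton] at hx
    rcases hx with rfl | rfl | rfl <;> simp [hO, ho₁, ho₂, ho₃]
  have hOcard : O.card = Fintype.card V + 1 := by
    have h1 := two_mul_sum_outInd h
    rw [hE] at h1
    have h2 : ∑ x, T.outInd x = O.card := by
      unfold outInd
      rw [Finset.sum_boole]
    rw [h2] at h1
    omega
  -- the increments of a function of the vertices on the remaining edges, and its value at the root
  let L : (V → ℚ) →ₗ[ℚ] ((↥(O \ B) → ℚ) × ℚ) :=
    { toFun := fun p => (fun x => p (T.vert (T.flip x)) - p (T.vert x), p T.rootVertex)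
      map_add' := by
        intro p q
        ext x <;> simp
        ring
      map_smul' := by
        intro a p
        ext x <;> simp
        ring }
  have hL : Function.Injective L := by
    rw [← LinearMap.ker_eq_bot, LinearMap.ker_eq_bot']
    intro p hp
    have hp1 : ∀ x ∈ O \ B, p (T.vert (T.flip x)) - p (T.vert x) = 0 := by
      intro x hx
      exact congrFun (congrArg Prod.fst hp) ⟨x, hx⟩
    have hp2 : p T.rootVertex = 0 := congrArg Prod.snd hp
    have hgen : ∀ x, ¬ T.IsStem x → ¬ (x = e₁ ∨ x = T.flip e₁) → ¬ (x = e₂ ∨ x = T.flip e₂) →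
        ¬ (x = d ∨ x = T.flip d) → p (T.vert (T.flip x)) = p (T.vert x) := by
      intro x hx a₁ a₂ a₃
      obtain ⟨y, hyo, hy⟩ := exists_out_half h hx
      have hyB : y ∉ B := by
        intro hyB
        simp only [hB, Finset.mem_insert, Finset.mem_singleton] at hyB
        rcases hyB with hyB | hyB | hyB
        · exact a₁ (eq_or_eq_flip (hyB ▸ hy₁) hy)
        · exact a₂ (eq_or_eq_flip (hyB ▸ hy₂) hy)
        · exact a₃ (eq_or_eq_flip (hyB ▸ hy₃) hy)
      have h2 := sub_eq_zero.1 (hp1 y (Finset.mem_sdiff.2 ⟨by simp [hO, hyo], hyB⟩))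
      rcases hy with rfl | rfl
      · exact h2
      · rw [hff] at h2
        exact h2.symm
    have hne : ∀ {X : Finset D} {x y : D}, x ∈ X → y ∉ X → T.flip y ∉ X →
        ¬ (x = y ∨ x = T.flip y) := by
      rintro X x y hx hy hy' (rfl | rfl)
      · exact hy hx
      · exact hy' hx
    have hself : ∀ {X : Finset D} {x y : D}, T.IsCirculation X → x ∈ X → y ∈ X → x ≠ y →
        ¬ (x = y ∨ x = T.flip y) := by
      rintro X x y hX hx hy hxy (rfl | rfl)
      · exact hxy rfl
      · exact hX.flip_notMem _ hy hx
    have he₁ : ∀ x, (x = e₁ ∨ x = T.flip e₁) → p (T.vert (T.flip x)) = p (T.vert x) :=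
      fun x => hX₁.increment_eq_zero h₁₁ p fun x hx hxe => hgen x (hX₁.not_isStem hx)
        (hself hX₁ hx h₁₁ hxe) (hne hx h₁₂ h₁₂') (hne hx h₁₃ h₁₃')
    have he₂ : ∀ x, (x = e₂ ∨ x = T.flip e₂) → p (T.vert (T.flip x)) = p (T.vert x) :=
      fun x => hX₂.increment_eq_zero h₂₂ p fun x hx hxe => hgen x (hX₂.not_isStem hx)
        (hne hx h₂₁ h₂₁') (hself hX₂ hx h₂₂ hxe) (hne hx h₂₃ h₂₃')
    have hgen' : ∀ x, ¬ T.IsStem x → ¬ (x = d ∨ x = T.flip d) →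
        p (T.vert (T.flip x)) = p (T.vert x) := by
      intro x hx a₃
      by_cases a₁ : x = e₁ ∨ x = T.flip e₁
      · exact he₁ x a₁
      by_cases a₂ : x = e₂ ∨ x = T.flip e₂
      · exact he₂ x a₂
      exact hgen x hx a₁ a₂ a₃
    have hall : ∀ x, p (T.vert (T.flip x)) = p (T.vert x) := by
      intro x
      by_cases hs : T.IsStem x
      · rw [show T.flip x = x from hs]
      by_cases a₃ : x = d ∨ x = T.flip d
      · exact hX₃.increment_eq_zero h₃₃ p (fun x hx hxe => hgen' x (hX₃.not_isStem hx)
          (hself hX₃ hx h₃₃ hxe)) a₃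
      exact hgen' x hs a₃
    have htour : ∀ i, p (T.vert (T.angle i)) = 0 := by
      intro i
      induction i with
      | zero => rw [angle_zero]; exact hp2
      | succ i ih =>
        rw [angle_succ, vert_face, hall, ih]
    funext v
    obtain ⟨x, rfl⟩ := T.vert_surjective v
    rw [← angle_idx h x]
    exact htour _
  have hrank := LinearMap.finrank_le_finrank_of_injective hL
  rw [Module.finrank_prod, Module.finrank_pi, Module.finrank_pi, Module.finrank_self,
    Fintype.card_coe, Finset.card_sdiff_of_subset hBO, hBcard, hOcard] at hrank
  have : 3 ≤ Fintype.card V + 1 := by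
    rw [← hOcard, ← hBcard]
    exact Finset.card_le_card hBO
  omega

/-- Crossing is a symmetric relation between edges. -/
theorem exists_mem_crossing_symm [Fintype D] {T : StemMap V D} (h : T.IsUnicellular) {d x : D}
    (hx : x ∈ T.crossing d) :
    ∃ y, T.idx y < T.idx (T.flip y) ∧ (d ∈ T.crossing y ∨ T.flip d ∈ T.crossing y) := by
  have hinj := idx_injective h
  rw [mem_crossing] at hx
  have h1 : T.idx (T.flip x) ≠ T.idx d := by
    intro h1
    have h2 : x = T.flip d := by rw [← hinj h1, T.flip_flip]
    rw [h2] at hx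
    omega
  have h2 : T.idx (T.flip x) ≠ T.idx (T.flip d) := by
    intro h1
    have h2 : x = d := T.flip.injective (hinj h1)
    rw [h2] at hx
    omega
  rcases lt_or_gt_of_ne h1 with h3 | h3
  · refine ⟨T.flip x, ?_, Or.inl ?_⟩
    · rw [T.flip_flip]
      omega
    · rw [mem_crossing, T.flip_flip]
      omega
  · refine ⟨x, by omega, Or.inr ?_⟩
    rw [mem_crossing, T.flip_flip]
    omega

/-- The half-edges crossing an edge, if any, form a single cycle. -/
theorem exists_crossing_eq_image [Fintype V] [Fintype D] [DecidableEq D] {T : StemMap V D}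
    (h : T.IsUnicellular) (hE : T.HasTorusEdges) {d : D} (hd : T.idx d < T.idx (T.flip d))
    (hne : (T.crossing d).Nonempty) :
    ∃ (k : ℕ) (c : Fin (k + 1) → D), T.IsCycle c ∧ T.crossing d = Finset.univ.image c := by
  have hX := isCirculation_crossing h hd
  obtain ⟨k, c, hc, hsub⟩ := hX.exists_isCycle hne
  refine ⟨k, c, hc, ?_⟩
  by_contra hneq
  have hY := isCirculation_image hc
  have hYX : Finset.univ.image c ⊆ T.crossing d := by
    intro x hx
    obtain ⟨i, -, rfl⟩ := Finset.mem_image.1 hx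
    exact hsub i
  have hZ := hX.sdiff hY hYX
  obtain ⟨e₂, he₂⟩ : (T.crossing d \ Finset.univ.image c).Nonempty := by
    rw [Finset.sdiff_nonempty]
    exact fun h1 => hneq (Finset.Subset.antisymm h1 hYX)
  have he₁ : c 0 ∈ Finset.univ.image c := Finset.mem_image_of_mem _ (Finset.mem_univ _)
  have hd1 : d ∉ T.crossing d := by rw [mem_crossing]; omega
  have hd2 : T.flip d ∉ T.crossing d := by rw [mem_crossing]; omega
  have hmem := Finset.mem_sdiff.1 he₂
  have hsub' : T.crossing d \ Finset.univ.image c ⊆ T.crossing d := Finset.sdiff_subset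
  obtain ⟨y, hy, hdy⟩ := exists_mem_crossing_symm h (hsub 0)
  have key : ∀ d', (d' ∉ T.crossing d) → (T.flip d' ∉ T.crossing d) → d' ∈ T.crossing y → False :=
    fun d' h1 h2 h3 => not_three_circulations h hE hY hZ (isCirculation_crossing h hy) he₁ hmem.2
      (fun h4 => hX.flip_notMem _ hmem.1 (hYX h4)) (fun h4 => h1 (hYX h4))
      (fun h4 => h2 (hYX h4)) (fun h4 => (Finset.mem_sdiff.1 h4).2 he₁)
      (fun h4 => hX.flip_notMem _ (hsub 0) (hsub' h4)) he₂ (fun h4 => h1 (hsub' h4))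
      (fun h4 => h2 (hsub' h4)) h3
  rcases hdy with h3 | h3
  · exact key d hd1 hd2 h3
  · exact key (T.flip d) hd2 (by rw [T.flip_flip]; exact hd1) h3

/-! ### Values of the flow -/

/-- A function on the darts with zero sum around every vertex is, up to a positive factor, the
variation of a function on the angles when rotating around the vertices. -/
theorem exists_potential [Fintype D] (T : StemMap V D) {z : D → ℤ}
    (hz : ∀ v, ∑ x ∈ T.dartsAt v, z x = 0) :
    ∃ N : ℤ, 0 < N ∧ ∃ p : D → ℤ, ∀ x, p (T.rot x) - p x = N * z x := by
  set N := orderOf T.rot with hN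
  have hNpos : 0 < N := orderOf_pos T.rot
  have hpow : ∀ x, (T.rot ^ N) x = x := by
    intro x
    rw [hN, pow_orderOf_eq_one]
    rfl
  have hrot : ∀ l x, (T.rot ^ l) (T.rot x) = (T.rot ^ (l + 1)) x := by
    intro l x
    rw [pow_succ, Equiv.Perm.mul_apply]
  set S : D → ℤ := fun x => ∑ l ∈ Finset.range N, z ((T.rot ^ l) x) with hS
  have hSrot : ∀ x, S (T.rot x) = S x := by
    intro x
    simp only [hS, hrot]
    have h1 := Finset.sum_range_succ (fun l => z ((T.rot ^ l) x)) N
    rw [Finset.sum_range_succ'] at h1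
    simp only [hpow, pow_zero, Equiv.Perm.coe_one, id_eq] at h1
    linarith
  have hSconst : ∀ x y, T.vert x = T.vert y → S y = S x := by
    intro x y hxy
    obtain ⟨k, rfl⟩ := ((T.vert_eq_iff x y).1 hxy).exists_nat_pow_eq
    clear hxy
    induction k with
    | zero => simp
    | succ k ih => rw [pow_succ', Equiv.Perm.mul_apply, hSrot, ih]
  have hpowsum : ∀ v l, ∑ x ∈ T.dartsAt v, z ((T.rot ^ l) x) = 0 := by
    intro v l
    induction l with
    | zero => simpa using hz v
    | succ l ih =>
      rw [← ih, ← T.sum_dartsAt_rot v fun x => z ((T.rot ^ l) x)]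
      simp [hrot]
  have hS0 : ∀ x, S x = 0 := by
    intro x
    have h1 : ∑ y ∈ T.dartsAt (T.vert x), S y = 0 := by
      simp only [hS]
      rw [Finset.sum_comm]
      exact Finset.sum_eq_zero fun l _ => hpowsum _ l
    rw [Finset.sum_congr rfl fun y hy => hSconst x y (mem_dartsAt.1 hy).symm,
      Finset.sum_const, smul_eq_zero] at h1
    refine h1.resolve_left fun h2 => ?_
    exact (T.dartsAt_nonempty (T.vert x)).ne_empty (Finset.card_eq_zero.1 h2)
  refine ⟨N, by exact_mod_cast hNpos,
    fun x => ∑ l ∈ Finset.range N, (l : ℤ) * z ((T.rot ^ l) x), fun x => ?_⟩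
  have h1 := Finset.sum_range_succ (fun l => (l : ℤ) * z ((T.rot ^ l) x)) N
  rw [Finset.sum_range_succ'] at h1
  have h2 : ∑ l ∈ Finset.range N, z ((T.rot ^ (l + 1)) x) = 0 := by
    rw [← hS0 (T.rot x)]
    simp [hS, hrot]
  simp only [Nat.cast_add, Nat.cast_one, add_mul, one_mul, Finset.sum_add_distrib, h2, hpow,
    Nat.cast_zero, zero_mul, add_zero] at h1
  simp only [hrot, h1]
  ring

/-- An antisymmetric function sums, over the part of the tour between the two halves of `d`, to its
sum over the half-edges crossing `d`. -/
theorem sum_Ico_angle_eq [Fintype D] {T : StemMap V D} (h : T.IsUnicellular) {d : D}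
    (hd : T.idx d < T.idx (T.flip d)) {e : D → ℤ} (he : ∀ x, e (T.flip x) = -e x) :
    ∑ i ∈ Finset.Ico (T.idx d) (T.idx (T.flip d) + 1), e (T.angle i)
      = ∑ x ∈ T.crossing d, e x := by
  classical
  set A : Finset D := Finset.univ.filter fun x =>
    T.idx d < T.idx x ∧ T.idx x < T.idx (T.flip d) with hA
  have hlt := idx_lt h (T.flip d)
  have h1 : ∑ i ∈ Finset.Ioo (T.idx d) (T.idx (T.flip d)), e (T.angle i) = ∑ x ∈ A, e x := by
    refine Finset.sum_bij' (fun i _ => T.angle i) (fun x _ => T.idx x) ?_ ?_ ?_ ?_ ?_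
    · intro i hi
      rw [Finset.mem_Ioo] at hi
      simp only [hA, Finset.mem_filter, Finset.mem_univ, true_and]
      rw [idx_angle h (by omega)]
      exact hi
    · intro x hx
      simp only [hA, Finset.mem_filter, Finset.mem_univ, true_and] at hx
      exact Finset.mem_Ioo.2 hx
    · intro i hi
      rw [Finset.mem_Ioo] at hi
      exact idx_angle h (by omega)
    · intro x _
      exact angle_idx h x
    · simp
  have h2 : ∑ i ∈ Finset.Ico (T.idx d) (T.idx (T.flip d) + 1), e (T.angle i) = ∑ x ∈ A, e x := by
    rw [Finset.sum_Ico_succ_top hd.le, Finset.sum_eq_sum_Ico_succ_bot hd, angle_idx h,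
      angle_idx h, he, ← h1]
    have : Finset.Ico (T.idx d + 1) (T.idx (T.flip d))
        = Finset.Ioo (T.idx d) (T.idx (T.flip d)) := by
      ext i
      simp only [Finset.mem_Ico, Finset.mem_Ioo]
      omega
    rw [this]
    ring
  have hswap : ∀ X : Finset D, ∑ x, memInd X (T.flip x) * e x = -∑ x ∈ X, e x := by
    intro X
    rw [← Equiv.sum_comp T.flip]
    simp only [T.flip_flip, he, mul_neg, Finset.sum_neg_distrib]
    rw [← sum_memInd_mul (R := ℤ) X e]
    simp
  have hself : ∀ X : Finset D, ∑ x, memInd X x * e x = ∑ x ∈ X, e x := by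
    intro X
    rw [← sum_memInd_mul (R := ℤ) X e]
    simp
  have h3 : ∀ x, memInd A x - memInd A (T.flip x)
      = memInd (T.crossing d) x - memInd (T.crossing d) (T.flip x) := by
    intro x
    unfold memInd
    simp only [mem_crossing, hA, Finset.mem_filter, Finset.mem_univ, true_and, T.flip_flip]
    by_cases ha : T.idx d < T.idx x ∧ T.idx x < T.idx (T.flip d) <;>
    by_cases hb : T.idx d < T.idx (T.flip x) ∧ T.idx (T.flip x) < T.idx (T.flip d) <;>
    simp [ha, hb]
  have h4 : ∑ x, (memInd A x - memInd A (T.flip x)) * e x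
      = ∑ x, (memInd (T.crossing d) x - memInd (T.crossing d) (T.flip x)) * e x :=
    Finset.sum_congr rfl fun x _ => by rw [h3]
  simp only [sub_mul, Finset.sum_sub_distrib, hswap, hself] at h4
  rw [h2]
  linarith

/-- Poincaré duality in the form needed here: a divergence-free function `z` vanishes on the
uncrossed edges, and its value at an edge crossed by a cycle is minus its flux through that
cycle. -/
theorem eq_neg_rightSum_of_divergence_free [Fintype D] [DecidableEq D] {T : StemMap V D}
    (h : T.IsUnicellular) {z : D → ℤ} (hz : ∀ v, ∑ x ∈ T.dartsAt v, z x = 0)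
    (hza : ∀ x, z (T.flip x) = -z x) {d : D} (hd : T.idx d < T.idx (T.flip d)) :
    (T.crossing d = ∅ → z d = 0) ∧
    ∀ (k : ℕ) (c : Fin (k + 1) → D), T.IsCycle c → T.crossing d = Finset.univ.image c →
      z d = -T.rightSum c z := by
  obtain ⟨N, hN, p, hp⟩ := T.exists_potential hz
  have hp' : ∀ x, p (T.rot x) = p x + N * z x := fun x => by rw [← hp x]; ring
  set e : D → ℤ := fun x => p (T.face x) - p x with he
  have hea : ∀ x, e (T.flip x) = -e x := by
    intro x
    simp only [he, face_apply, T.flip_flip, hp', hza]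
    ring
  have h1 := sum_Ico_angle_eq h hd hea
  have h2 : ∑ i ∈ Finset.Ico (T.idx d) (T.idx (T.flip d) + 1), e (T.angle i) = N * z d := by
    have h3 : ∀ i, e (T.angle i) = p (T.angle (i + 1)) - p (T.angle i) := by
      intro i
      rw [angle_succ]
    simp_rw [h3]
    rw [Finset.sum_Ico_sub (fun i => p (T.angle i)) (by omega), angle_succ, angle_idx h,
      angle_idx h, ← rot_eq_face_flip, hp]
  rw [h2] at h1
  refine ⟨fun hX => ?_, fun k c hc hX => ?_⟩
  · rw [hX, Finset.sum_empty] at h1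
    exact (mul_eq_zero.1 h1).resolve_left hN.ne'
  · rw [hX, Finset.sum_image fun i _ j _ hij => hc.injective' hij] at h1
    have h4 := rightSum_rot_sub hc p
    have h5 : T.rightSum c (fun x => p (T.rot x) - p x) = N * T.rightSum c z := by
      rw [← rightSum_const_mul]
      exact congrArg _ (funext hp)
    have h6 : ∑ i, (p (c i) - p (T.face (c i))) = -∑ i, e (c i) := by
      rw [← Finset.sum_neg_distrib]
      exact Finset.sum_congr rfl fun i _ => by simp [he]
    rw [h5, h6, ← h1] at h4
    have h7 : N * (z d + T.rightSum c z) = 0 := by linarith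
    have := (mul_eq_zero.1 h7).resolve_left hN.ne'
    linarith

/-- The combinatorial content of the hypotheses on rooted balanced toroidal unicellular maps. -/
structure IsBalancedTorus [Fintype V] [Fintype D] (T : StemMap V D) : Prop where
  unicellular : T.IsUnicellular
  edges : T.HasTorusEdges
  label_card : T.label (Nat.card D) = 0
  outdegree : T.HasOutdegreeThree
  balanced : T.IsBalanced

theorem exists_excess_eq [Fintype V] [DecidableEq V] [Fintype D] {T : StemMap V D}
    (h : T.IsUnicellular) (hE : T.HasTorusEdges) :
    ∃ x₁ x₂ : V, ∀ v, T.excess v = (if x₁ = v then 1 else 0) + if x₂ = v then 1 else 0 := by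
  have h0 := excess_nonneg h
  have h1 := sum_excess h hE
  obtain ⟨x₁, hx₁⟩ : ∃ v, 0 < T.excess v := by
    by_contra hne
    push Not at hne
    have := Finset.sum_nonpos fun v (_ : v ∈ Finset.univ) => hne v
    omega
  have h2 : ∑ v, (T.excess v - if x₁ = v then 1 else 0) = 1 := by
    rw [Finset.sum_sub_distrib, h1]
    simp
  have h3 : ∀ v, 0 ≤ T.excess v - if x₁ = v then 1 else 0 := by
    intro v
    split_ifs with hv
    · subst hv
      omega
    · have := h0 v
      omega
  obtain ⟨x₂, hx₂⟩ : ∃ v, 0 < T.excess v - if x₁ = v then 1 else 0 := by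
    by_contra hne
    push Not at hne
    have := Finset.sum_nonpos fun v (_ : v ∈ Finset.univ) => hne v
    omega
  have h4 : ∑ v, (T.excess v - (if x₁ = v then 1 else 0) - if x₂ = v then 1 else 0) = 0 := by
    rw [Finset.sum_sub_distrib, h2]
    simp
  have h5 : ∀ v, 0 ≤ T.excess v - (if x₁ = v then 1 else 0) - if x₂ = v then 1 else 0 := by
    intro v
    have := h3 v
    by_cases hv : x₂ = v
    · subst hv
      rw [if_pos rfl]
      omega
    · rw [if_neg hv]
      omega
  refine ⟨x₁, x₂, fun v => ?_⟩
  have := (Finset.sum_eq_zero_iff_of_nonneg fun v _ => h5 v).1 h4 v (Finset.mem_univ v)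
  linarith

/-- The flow minus three times the flows along the tour to angles `t₁`, `t₂` of the special vertices
is divergence-free. -/
theorem flow_eq_of_angles [Fintype V] [Fintype D] [DecidableEq D] [DecidableEq V]
    {T : StemMap V D} (hT : T.IsBalancedTorus) {t₁ t₂ : D}
    (ht : ∀ v, T.excess v = (if T.vert t₁ = v then 1 else 0) + if T.vert t₂ = v then 1 else 0)
    {d : D} (hd : T.idx d < T.idx (T.flip d)) :
    (T.crossing d = ∅ → T.flow d = 3 * (T.tourFlow t₁ d + T.tourFlow t₂ d)) ∧
    ∀ (k : ℕ) (c : Fin (k + 1) → D), T.IsCycle c → T.crossing d = Finset.univ.image c →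
      T.flow d = 3 * (T.tourFlow t₁ d + T.tourFlow t₂ d)
        - 3 * (1 - T.inRight c t₁ - T.inRight c t₂) := by
  have h := hT.unicellular
  set z : D → ℤ := fun x => T.flow x - 3 * (T.tourFlow t₁ x + T.tourFlow t₂ x) with hz
  have hdiv : ∀ v, ∑ x ∈ T.dartsAt v, z x = 0 := by
    intro v
    simp only [hz]
    rw [Finset.sum_sub_distrib, ← Finset.mul_sum, Finset.sum_add_distrib,
      sum_dartsAt_flow h hT.label_card hT.outdegree, sum_dartsAt_tourFlow h,
      sum_dartsAt_tourFlow h]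
    have := ht v
    by_cases e1 : T.vert t₁ = v <;> by_cases e2 : T.vert t₂ = v <;>
      by_cases e3 : v = T.rootVertex <;> simp only [e1, e2, e3, if_true, if_false] at this ⊢ <;>
      simp_all
  have hanti : ∀ x, z (T.flip x) = -z x := by
    intro x
    simp only [hz, flow_flip h, tourFlow_flip]
    ring
  obtain ⟨h1, h2⟩ := eq_neg_rightSum_of_divergence_free h hdiv hanti hd
  refine ⟨fun hX => ?_, fun k c hc hX => ?_⟩
  · have := h1 hX
    simp only [hz] at this
    linarith
  · have h3 := h2 k c hc hX
    have h4 : T.rightSum c z = T.rightSum c T.flow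
        - 3 * (T.rightSum c (T.tourFlow t₁) + T.rightSum c (T.tourFlow t₂)) := by
      rw [← rightSum_add, ← rightSum_const_mul, ← rightSum_sub]
    rw [h4, rightSum_flow h hT.edges hT.label_card hT.outdegree hT.balanced hc,
      rightSum_tourFlow h hc, rightSum_tourFlow h hc] at h3
    simp only [hz] at h3
    linarith

/-- On an uncrossed edge, the flow is `0`, `3` or `6` towards the root. -/
theorem flow_of_crossing_eq_empty [Fintype V] [Fintype D] {T : StemMap V D}
    (hT : T.IsBalancedTorus) {d : D} (hd : T.idx d < T.idx (T.flip d)) (hX : T.crossing d = ∅) :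
    T.flow d = 0 ∨ T.flow d = -3 ∨ T.flow d = -6 := by
  classical
  obtain ⟨x₁, x₂, hx⟩ := exists_excess_eq hT.unicellular hT.edges
  obtain ⟨t₁, rfl⟩ := T.vert_surjective x₁
  obtain ⟨t₂, rfl⟩ := T.vert_surjective x₂
  have h1 := (flow_eq_of_angles hT hx hd).1 hX
  have h2 : ∀ t, T.tourFlow t d = 0 ∨ T.tourFlow t d = -1 := by
    intro t
    unfold tourFlow
    split_ifs <;> omega
  rcases h2 t₁ with h3 | h3 <;> rcases h2 t₂ with h4 | h4 <;> rw [h3, h4] at h1 <;> omega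

/-- On a crossed edge, the flow is `3` towards the root. The half-edges crossing the edge form
a cycle through the special vertices; the angles from which this cycle leaves them are on its right
side and between the two halves of the edge. -/
theorem flow_of_crossing_nonempty [Fintype V] [Fintype D] {T : StemMap V D}
    (hT : T.IsBalancedTorus) {d : D} (hd : T.idx d < T.idx (T.flip d))
    (hX : (T.crossing d).Nonempty) : T.flow d = -3 := by
  classical
  have h := hT.unicellular
  obtain ⟨x₁, x₂, hx⟩ := exists_excess_eq h hT.edges
  obtain ⟨k, c, hc, hXc⟩ := exists_crossing_eq_image h hT.edges hd hX
  obtain ⟨i₁, hi₁⟩ := isSpecial_of_excess_pos h hT.edges (v := x₁) (by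
    rw [hx, if_pos rfl]; split_ifs <;> norm_num) k c hc
  obtain ⟨i₂, hi₂⟩ := isSpecial_of_excess_pos h hT.edges (v := x₂) (by
    rw [hx, if_pos (rfl : x₂ = x₂)]; split_ifs <;> norm_num) k c hc
  subst hi₁ hi₂
  have h1 := (flow_eq_of_angles hT hx hd).2 k c hc hXc
  have h2 : ∀ i, T.tourFlow (c i) d = -1 := by
    intro i
    have hmem : c i ∈ T.crossing d := by
      rw [hXc]
      exact Finset.mem_image_of_mem _ (Finset.mem_univ _)
    have h3 := (mem_crossing.1 hmem).1
    unfold tourFlow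
    rw [if_neg (by omega), if_pos (by omega)]
    norm_num
  rw [h2, h2, inRight_self hc, inRight_self hc] at h1
  linarith

/-! ### Variation of the labels at a vertex -/

open Classical in
/-- The variation of the labels when the dart `x` is passed while rotating around its vertex, where
the root angle gets its final label when it is reached. -/
def turn (T : StemMap V D) (x : D) : ℤ :=
  T.lab (T.rot x) - T.lab x - 3 * if T.rot x = T.root then 1 else 0

open Classical in
/-- The labels increase by at most one around a stem and around an outgoing half-edge, except that
they increase by at most four around the outgoing half-edge of an uncrossed edge. They do not
increase around the other half-edges. -/
theorem max_turn_le [Fintype V] [Fintype D] {T : StemMap V D} (hT : T.IsBalancedTorus) (x : D) :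
    max (T.turn x) 0 ≤ T.stemInd x + T.outInd x
      + 3 * if T.OutEdge x ∧ T.crossing (T.flip x) = ∅ then 1 else 0 := by
  have h := hT.unicellular
  have h1 : T.turn x = T.flow x - 2 * T.outInd x + T.stemInd x := by
    rw [flow_eq h hT.label_card, turn]
    ring
  have hflow : ∀ d, T.idx d < T.idx (T.flip d) →
      (T.flow d = 0 ∨ T.flow d = -3 ∨ T.flow d = -6) := by
    intro d hd
    rcases Finset.eq_empty_or_nonempty (T.crossing d) with hX | hX
    · exact flow_of_crossing_eq_empty hT hd hX
    · exact Or.inr (Or.inl (flow_of_crossing_nonempty hT hd hX))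
  rw [h1]
  by_cases hs : T.IsStem x
  · have h2 : T.flow x = 0 := by
      have := flow_flip h x
      rw [show T.flip x = x from hs] at this
      omega
    have h3 : ¬ T.OutEdge x := fun ho => not_isStem_of_outEdge ho hs
    have h4 : T.outInd x = 0 := if_neg h3
    rw [h2, h4, stemInd_of_isStem hs]
    simp [h3]
  · rw [stemInd_of_not hs]
    rcases outEdge_or_lt h hs with ho | hin
    · have h4 : T.outInd x = 1 := if_pos ho
      have hlt : T.idx (T.flip x) < T.idx (T.flip (T.flip x)) := by
        rw [T.flip_flip]
        exact ho
      have h5 := flow_flip h x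
      rw [h4]
      by_cases hX : T.crossing (T.flip x) = ∅
      · rw [if_pos ⟨ho, hX⟩]
        rcases hflow _ hlt with h6 | h6 | h6 <;> rw [h6] at h5 <;> omega
      · rw [if_neg fun h => hX h.2]
        rw [flow_of_crossing_nonempty hT hlt (Finset.nonempty_iff_ne_empty.2 hX)] at h5
        omega
    · have h3 : ¬ T.OutEdge x := fun ho => lt_asymm hin ho
      have h4 : T.outInd x = 0 := if_neg h3
      rw [h4, if_neg fun h => h3 h.1]
      rcases hflow x hin with h6 | h6 | h6 <;> omega

open Classical in
theorem sum_max_turn_le [Fintype V] [Fintype D] {T : StemMap V D} (hT : T.IsBalancedTorus)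
    (v : V) : ∑ x ∈ T.dartsAt v, max (T.turn x) 0 ≤ 6 - 3 * if v = T.rootVertex then 1 else 0 := by
  have h := hT.unicellular
  have h1 := Finset.sum_le_sum fun x (_ : x ∈ T.dartsAt v) => max_turn_le hT x
  rw [Finset.sum_add_distrib, hT.outdegree v, ← Finset.mul_sum, Finset.sum_boole] at h1
  have h2 : ((T.dartsAt v).filter fun x => T.OutEdge x ∧ T.crossing (T.flip x) = ∅).card
      + (if v = T.rootVertex then 1 else 0) ≤ 1 := by
    split_ifs with hv
    · rw [add_le_iff_nonpos_left, nonpos_iff_eq_zero, Finset.card_eq_zero,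
        Finset.filter_eq_empty_iff]
      rintro x hx ⟨ho, hX⟩
      rw [mem_dartsAt] at hx
      have := (idx_le_of_outEdge h ho hX (y := T.root) (hx.trans hv)).1
      rw [idx_root h] at this
      omega
    · rw [add_zero, Finset.card_le_one]
      intro x hx y hy
      rw [Finset.mem_filter, mem_dartsAt] at hx hy
      have e1 := (idx_le_of_outEdge h hx.2.1 hx.2.2 (hx.1.trans hy.1.symm)).2
      have e2 := (idx_le_of_outEdge h hy.2.1 hy.2.2 (hy.1.trans hx.1.symm)).2
      exact idx_injective h (le_antisymm e2 e1)
  split_ifs at h2 ⊢ <;> omega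

open Classical in
theorem lab_sub_lab_eq [Fintype D] (T : StemMap V D) {x y : D} (hxy : x ≠ y)
    (hv : T.vert x = T.vert y) :
    T.lab y - T.lab x = ∑ u ∈ insert x (T.arc x y), T.turn u
      + 3 * ∑ u ∈ insert x (T.arc x y), if T.rot u = T.root then 1 else 0 := by
  have h1 := T.sum_arc hxy hv T.lab
  have h2 := left_notMem_arc hxy hv
  have h3 : ∑ u ∈ insert x (T.arc x y), (T.lab (T.rot u) - T.lab u) = T.lab y - T.lab x := by
    rw [Finset.sum_insert h2, h1]
    ring
  rw [← h3, Finset.mul_sum, ← Finset.sum_add_distrib]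
  exact Finset.sum_congr rfl fun u _ => by rw [turn]; ring

open Classical in
theorem insert_arc_subset [Fintype D] (T : StemMap V D) (x y : D) :
    insert x (T.arc x y) ⊆ T.dartsAt (T.vert x) := by
  intro u hu
  rw [mem_dartsAt]
  rcases Finset.mem_insert.1 hu with rfl | hu
  · rfl
  · exact vert_of_mem_arc hu

open Classical in
theorem sum_turn_le [Fintype V] [Fintype D] {T : StemMap V D} (hT : T.IsBalancedTorus)
    (x y : D) : ∑ u ∈ insert x (T.arc x y), T.turn u
      ≤ 6 - 3 * if T.vert x = T.rootVertex then 1 else 0 :=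
  calc ∑ u ∈ insert x (T.arc x y), T.turn u
      ≤ ∑ u ∈ insert x (T.arc x y), max (T.turn u) 0 :=
        Finset.sum_le_sum fun _ _ => le_max_left _ _
    _ ≤ ∑ u ∈ T.dartsAt (T.vert x), max (T.turn u) 0 :=
        Finset.sum_le_sum_of_subset_of_nonneg (T.insert_arc_subset x y)
          fun _ _ _ => le_max_right _ _
    _ ≤ _ := sum_max_turn_le hT _

/-- The labels of the angles of a vertex differ by at most six. -/
theorem lab_le_add_six [Fintype V] [Fintype D] {T : StemMap V D} (hT : T.IsBalancedTorus)
    {x y : D} (hv : T.vert x = T.vert y) : T.lab y ≤ T.lab x + 6 := by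
  classical
  by_cases hxy : x = y
  · subst hxy
    omega
  have h1 := T.lab_sub_lab_eq hxy hv
  have h2 := sum_turn_le hT x y
  have h3 : ∑ u ∈ insert x (T.arc x y), (if T.rot u = T.root then (1 : ℤ) else 0)
      ≤ if T.vert x = T.rootVertex then 1 else 0 := by
    refine (Finset.sum_le_sum_of_subset_of_nonneg (T.insert_arc_subset x y)
      fun u _ _ => by split_ifs <;> norm_num).trans ?_
    rw [sum_dartsAt_rot_eq]
    exact (if_congr (eq_comm : T.vert T.root = T.vert x ↔ _) rfl rfl).le
  linarith

/-- The labels of the angles of the root vertex are at most six, hence differ by at most six from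
the final label `0` of the root angle. -/
theorem lab_le_six [Fintype V] [Fintype D] {T : StemMap V D} (hT : T.IsBalancedTorus)
    {y : D} (hv : T.vert y = T.rootVertex) : T.lab y ≤ 6 := by
  classical
  have hr := lab_root hT.unicellular
  by_cases hxy : T.root = y
  · rw [← hxy, hr]
    norm_num
  have h1 := T.lab_sub_lab_eq hxy hv.symm
  have h2 := sum_turn_le hT T.root y
  rw [if_pos (show T.vert T.root = T.rootVertex from rfl)] at h2
  have h3 : ∑ u ∈ insert T.root (T.arc T.root y), (if T.rot u = T.root then (1 : ℤ) else 0)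
      = 0 := by
    have h4 := T.sum_arc hxy hv.symm fun u => if u = T.root then (1 : ℤ) else 0
    have h5 := left_notMem_arc hxy hv.symm
    have h6 : ∑ u ∈ T.arc T.root y, (if u = T.root then (1 : ℤ) else 0) = 0 := by
      refine Finset.sum_eq_zero fun u hu => if_neg ?_
      rintro rfl
      exact h5 hu
    rw [Finset.sum_sub_distrib, h6, if_neg (Ne.symm hxy)] at h4
    rw [Finset.sum_insert h5]
    linarith
  rw [h3] at h1
  linarith

/-! ### The closure procedure -/

section Attach

variable (M : StemMap V D) (s c : D) (hs : M.IsStem s)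

theorem attach_flip_none : (M.attach s c hs).flip none = some s := by
  have h : M.flip s = s := hs
  simp [attach, h]

theorem attach_flip_self : (M.attach s c hs).flip (some s) = none := by
  simp [attach]

theorem attach_flip_of_ne {x : D} (hx : x ≠ s) :
    (M.attach s c hs).flip (some x) = some (M.flip x) := by
  classical
  have h1 : Equiv.swap (none : Option D) (some s) (some x) = some x :=
    Equiv.swap_apply_of_ne_of_ne (by simp) (by simpa using hx)
  have h2 : (M.flip.optionCongr * Equiv.swap none (some s)) (some x) = some (M.flip x) := by
    rw [Equiv.Perm.mul_apply, h1]
    simp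
  rw [← h2]
  simp only [attach]

theorem attach_isStem_some {x : D} :
    (M.attach s c hs).IsStem (some x) ↔ x ≠ s ∧ M.IsStem x := by
  unfold IsStem
  by_cases hx : x = s
  · subst hx
    simp [attach_flip_self]
  · rw [attach_flip_of_ne M s c hs hx]
    simp [hx]

theorem attach_not_isStem_none : ¬ (M.attach s c hs).IsStem none := by
  unfold IsStem
  simp [attach_flip_none]

theorem attach_face_self : (M.attach s c hs).face (some s) = some c := by
  rw [face_apply, attach_flip_self]
  exact insertBefore_none _ _

theorem attach_face_of_ne {x : D} (hx : x ≠ s) (hc : M.face x ≠ c) :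
    (M.attach s c hs).face (some x) = some (M.face x) := by
  rw [face_apply, attach_flip_of_ne M s c hs hx]
  have h1 := insertBefore_some M.rot c (M.flip x)
  rw [← face_apply, if_neg hc] at h1
  exact h1

end Attach

theorem ClosesTo.finite.{u, v} {V : Type u} {D : Type v} [Finite D] {T : StemMap V D}
    {D' : Type v} {M : StemMap V D'} (hM : T.ClosesTo M) : Finite D' := by
  induction hM with
  | refl => infer_instance
  | close hM s hs ih => infer_instance

/-- The angle `a_j` is the successor of `a_i`: the first angle after `a_i` with a smaller label. -/
structure IsSucc [Finite D] (T : StemMap V D) (i j : ℕ) : Prop where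
  lt : i < j
  le_card : j ≤ Nat.card D
  label_eq : T.label j + 1 = T.label i
  le_label : ∀ k, i < k → k < j → T.label i ≤ T.label k

/-- The state of a partial closure `M` of `T`. The darts of `T` are embedded in those of `M` by `e`;
`O` is the set of indices of the darts of `T` that are still on the border of the face of the root,
in the same order as in `T`. Every edge of `M` joins an angle of `T` to its successor. -/
structure IsPartialClosure [Finite D] {D' : Type*} (T : StemMap V D) (M : StemMap V D')
    (e : D → D') (O : Set ℕ) : Prop where
  injective : Function.Injective e
  vert : ∀ d, M.vert (e d) = T.vert d
  root : e T.root = M.root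
  cover : ∀ x, ∃ d, x = e d ∨ x = M.flip (e d)
  edge : ∀ i < Nat.card D, ¬ M.IsStem (e (T.angle i)) →
    ∃ j, T.IsSucc i j ∧ M.vert (M.flip (e (T.angle i))) = T.vert (T.angle j)
  stem : ∀ x, M.IsStem x → ∃ i ∈ O, x = e (T.angle i)
  isStem : ∀ d, M.IsStem (e d) → T.IsStem d
  zero_mem : 0 ∈ O
  lt_card : ∀ i ∈ O, i < Nat.card D
  face : ∀ i ∈ O, ∃ j, i < j ∧ (j = Nat.card D ∨ j ∈ O) ∧
    M.face (e (T.angle i)) = e (T.angle j) ∧ (M.IsStem (e (T.angle i)) → j = i + 1) ∧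
    (¬ M.IsStem (e (T.angle i)) → T.IsSucc i j)

theorem isSucc_succ [Finite D] {T : StemMap V D} {i : ℕ} (hi : i < Nat.card D)
    (hs : ¬ T.IsStem (T.angle i)) : T.IsSucc i (i + 1) where
  lt := Nat.lt_succ_self i
  le_card := hi
  label_eq := by
    rw [label_succ, step, if_neg hs]
    ring
  le_label k h1 h2 := by omega

theorem isPartialClosure_refl [Finite D] {T : StemMap V D} (h : T.IsUnicellular) :
    T.IsPartialClosure T id {i | i < Nat.card D} where
  injective := Function.injective_id
  vert _ := rfl
  root := rfl
  cover x := ⟨x, Or.inl rfl⟩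
  edge i hi hs := ⟨i + 1, isSucc_succ hi hs, by rw [angle_succ, vert_face]; rfl⟩
  stem x _ := ⟨T.idx x, idx_lt h x, (angle_idx h x).symm⟩
  isStem _ hs := hs
  zero_mem := T.card_pos
  lt_card _ hi := hi
  face i hi := by
    refine ⟨i + 1, Nat.lt_succ_self i, ?_, (T.angle_succ i).symm, fun _ => rfl,
      fun hs => isSucc_succ hi hs⟩
    rcases Nat.lt_or_ge (i + 1) (Nat.card D) with h1 | h1
    · exact Or.inr h1
    · exact Or.inl (le_antisymm hi h1)

/-- Closing a triple of a partial closure without wrapping over the root angle. -/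
theorem IsPartialClosure.closeTriple [Finite D] {D' : Type*} {T : StemMap V D}
    (h : T.IsUnicellular) {M : StemMap V D'} {e : D → D'} {O : Set ℕ}
    (hM : T.IsPartialClosure M e O) {s : D'} (hs : M.Admissible s) (h1 : M.face s ≠ M.root)
    (h2 : M.face (M.face s) ≠ M.root) :
    ∃ O', T.IsPartialClosure (M.closeTriple s hs) (fun d => some (e d)) O' := by
  have hroot : e (T.angle (Nat.card D)) = M.root := by rw [angle_card h, hM.root]
  have hinj : ∀ {i j}, i < Nat.card D → j < Nat.card D → e (T.angle i) = e (T.angle j) →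
      i = j := by
    intro i j hi hj hij
    rw [← idx_angle h hi, ← idx_angle h hj, hM.injective hij]
  obtain ⟨i, hi, rfl⟩ := hM.stem s hs.isStem
  obtain ⟨i₁, hlt₁, hO₁, hf₁, hstem₁, -⟩ := hM.face i hi
  have hi₁ : i₁ ∈ O := by
    refine hO₁.resolve_left fun h3 => h1 ?_
    rw [hf₁, h3, hroot]
  have hn₁ : ¬ M.IsStem (e (T.angle i₁)) := hf₁ ▸ hs.edge₂
  obtain ⟨i₂, hlt₂, hO₂, hf₂, -, hsucc₂⟩ := hM.face i₁ hi₁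
  have hi₂ : i₂ ∈ O := by
    refine hO₂.resolve_left fun h3 => h2 ?_
    rw [hf₁, hf₂, h3, hroot]
  have hn₂ : ¬ M.IsStem (e (T.angle i₂)) := by
    have := hs.edge₁
    rwa [hf₁, hf₂] at this
  obtain ⟨i₃, hlt₃, hO₃, hf₃, -, hsucc₃⟩ := hM.face i₂ hi₂
  have hs₂ := hsucc₂ hn₁
  have hs₃ := hsucc₃ hn₂
  have hlab : T.label i₁ = T.label i + 1 := by
    rw [hstem₁ hs.isStem, label_succ, step, if_pos (hM.isStem _ hs.isStem)]
  -- the attached stem joins its angle to the successor of this angle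
  have hsucc : T.IsSucc i i₃ := by
    refine ⟨by omega, hs₃.le_card, ?_, ?_⟩
    · have := hs₂.label_eq
      have := hs₃.label_eq
      omega
    · intro k hk1 hk2
      have e1 := hs₂.label_eq
      have e2 := hstem₁ hs.isStem
      rcases lt_trichotomy k i₂ with h3 | h3 | h3
      · rcases eq_or_lt_of_le (show i₁ ≤ k by omega) with h4 | h4
        · rw [← h4]
          omega
        · have := hs₂.le_label k h4 h3
          omega
      · rw [h3]
        omega
      · have := hs₃.le_label k h3 hk2
        omega
  have hc : M.face (M.face (M.face (e (T.angle i)))) = e (T.angle i₃) := by rw [hf₁, hf₂, hf₃]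
  have hilt := hM.lt_card i hi
  have hi₁lt := hM.lt_card i₁ hi₁
  have hi₂lt := hM.lt_card i₂ hi₂
  unfold StemMap.closeTriple
  rw! [hc]
  refine ⟨O \ {i₁, i₂}, ?_, ?_, ?_, ?_, ?_, ?_, ?_, ?_, ?_, ?_⟩
  · exact (Option.some_injective _).comp hM.injective
  · exact hM.vert
  · exact congrArg some hM.root
  · intro x
    cases x with
    | none => exact ⟨T.angle i, Or.inr (M.attach_flip_self _ _ _).symm⟩
    | some x =>
      obtain ⟨d, hd | hd⟩ := hM.cover x
      · exact ⟨d, Or.inl (congrArg some hd)⟩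
      · by_cases hds : e d = e (T.angle i)
        · refine ⟨d, Or.inl ?_⟩
          rw [hd, hds, show M.flip (e (T.angle i)) = e (T.angle i) from hs.isStem]
        · exact ⟨d, Or.inr (by rw [hd, M.attach_flip_of_ne _ _ _ hds])⟩
  · intro k hk hns
    by_cases hks : e (T.angle k) = e (T.angle i)
    · have := hinj hk hilt hks
      subst this
      exact ⟨i₃, hsucc, by rw [M.attach_flip_self]; exact hM.vert _⟩
    · rw [attach_isStem_some] at hns
      obtain ⟨j, hj1, hj2⟩ := hM.edge k hk fun h3 => hns ⟨hks, h3⟩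
      exact ⟨j, hj1, by rw [M.attach_flip_of_ne _ _ _ hks]; exact hj2⟩
  · intro x hx
    cases x with
    | none => exact absurd hx (M.attach_not_isStem_none _ _ _)
    | some x =>
      rw [attach_isStem_some] at hx
      obtain ⟨k, hk, rfl⟩ := hM.stem x hx.2
      refine ⟨k, ⟨hk, ?_⟩, rfl⟩
      rintro (rfl | rfl)
      · exact hn₁ hx.2
      · exact hn₂ hx.2
  · intro d hd
    rw [attach_isStem_some] at hd
    exact hM.isStem d hd.2
  · refine ⟨hM.zero_mem, ?_⟩
    rintro (h3 | h3)
    · omega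
    · have h3' : 0 = i₂ := h3
      omega
  · exact fun k hk => hM.lt_card k hk.1
  · rintro k ⟨hk, hk'⟩
    have hk₁ : k ≠ i₁ := fun h3 => hk' (Or.inl h3)
    have hk₂ : k ≠ i₂ := fun h3 => hk' (Or.inr h3)
    have hklt := hM.lt_card k hk
    by_cases hks : k = i
    · subst hks
      refine ⟨i₃, by omega, ?_, M.attach_face_self _ _ _, ?_, fun _ => hsucc⟩
      · refine hO₃.imp_right fun h3 => ⟨h3, ?_⟩
        rintro (h4 | h4)
        · omega
        · have h4' : i₃ = i₂ := h4
          omega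
      · intro h3
        rw [attach_isStem_some] at h3
        exact absurd rfl h3.1
    · have hne : e (T.angle k) ≠ e (T.angle i) := fun h3 => hks (hinj hklt hilt h3)
      obtain ⟨j, hj, hjO, hjf, hjs, hjn⟩ := hM.face k hk
      refine ⟨j, hj, ?_, ?_, ?_, ?_⟩
      · refine hjO.imp_right fun h3 => ⟨h3, ?_⟩
        rintro (h4 | h4)
        · rw [h4, ← hf₁] at hjf
          exact hne (M.face.injective hjf)
        · have h4' : j = i₂ := h4
          rw [h4', ← hf₂] at hjf
          exact hk₁ (hinj hklt hi₁lt (M.face.injective hjf))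
      · rw [M.attach_face_of_ne _ _ _ hne, hjf]
        rw [← hf₃]
        exact fun h3 => hk₂ (hinj hklt hi₂lt (M.face.injective h3))
      · intro h3
        rw [attach_isStem_some] at h3
        exact hjs h3.2
      · intro h3
        rw [attach_isStem_some] at h3
        exact hjn fun h4 => h3 ⟨hne, h4⟩

theorem ClosesTo.exists_isPartialClosure.{u, v} {V : Type u} {D : Type v} [Finite D]
    {T : StemMap V D} (h : T.IsUnicellular) (hsafe : T.IsSafe) {D' : Type v} {M : StemMap V D'}
    (hM : T.ClosesTo M) : ∃ e O, T.IsPartialClosure M e O := by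
  induction hM with
  | refl => exact ⟨_, _, isPartialClosure_refl h⟩
  | close hM s hs ih =>
    obtain ⟨e, O, hP⟩ := ih
    obtain ⟨h1, h2⟩ := hsafe _ _ hM s hs
    obtain ⟨O', hO'⟩ := hP.closeTriple h hs h1 h2
    exact ⟨_, O', hO'⟩

theorem abs_label_sub_le (T : StemMap V D) (i : ℕ) : |T.label i - 3| ≤ i := by
  induction i with
  | zero => simp [label]
  | succ i ih =>
    rw [label_succ, step]
    rw [abs_le] at ih ⊢
    push_cast
    split_ifs <;> omega

/-- A partial closure with a stem has an admissible triple. Otherwise, no stem of its outer face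
would be followed by two edges, and the labels could not decrease by three at each turn around
this face. -/
theorem IsPartialClosure.exists_admissible [Finite D] {D' : Type*} {T : StemMap V D}
    (h : T.IsUnicellular) (hl : T.label (Nat.card D) = 0) {M : StemMap V D'} {e : D → D'}
    {O : Set ℕ} (hM : T.IsPartialClosure M e O) {s₀ : D'} (hs₀ : M.IsStem s₀) :
    ∃ s, M.Admissible s := by
  by_contra hne
  push Not at hne
  set u : ℕ → D' := fun k => (M.face ^ k) s₀ with hu
  have husucc : ∀ k, u (k + 1) = M.face (u k) := by
    intro k
    simp [hu, pow_succ']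
  set w : ℕ → ℤ := fun k => ∑ l ∈ Finset.range k, M.step (u l) with hw
  have hwsucc : ∀ k, w (k + 1) = w k + M.step (u k) := fun k => Finset.sum_range_succ _ _
  have hnonneg : ∀ k, 0 ≤ w k ∧ (M.IsStem (u k) ∨
      (1 ≤ w k ∧ ∃ l, l + 1 = k ∧ M.IsStem (u l))) := by
    intro k
    induction k with
    | zero => exact ⟨le_rfl, Or.inl hs₀⟩
    | succ k ih =>
      obtain ⟨h0, h1⟩ := ih
      by_cases hk : M.IsStem (u k)
      · have h2 : w (k + 1) = w k + 1 := by rw [hwsucc, step, if_pos hk]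
        exact ⟨by omega, Or.inr ⟨by omega, k, rfl, hk⟩⟩
      · have h2 : w (k + 1) = w k - 1 := by rw [hwsucc, step, if_neg hk]; ring
        obtain ⟨h3, l, rfl, hl⟩ := h1.resolve_left hk
        refine ⟨by omega, Or.inl ?_⟩
        by_contra h4
        refine hne (u l) ⟨hl, ?_, ?_⟩
        · rwa [← husucc]
        · rwa [← husucc, ← husucc]
  obtain ⟨i₀, hi₀, hsi₀⟩ := hM.stem s₀ hs₀
  -- `m` counts the passages at the root angle
  have hpos : ∀ k, ∃ i ∈ O, ∃ m : ℕ, u k = e (T.angle i) ∧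
      w k = T.label i - T.label i₀ - 3 * m ∧ k ≤ i + Nat.card D * m := by
    intro k
    induction k with
    | zero => exact ⟨i₀, hi₀, 0, hsi₀, by simp [hw], by omega⟩
    | succ k ih =>
      obtain ⟨i, hi, m, hui, hwi, hki⟩ := ih
      obtain ⟨j, hij, hjO, hf, hjs, hjn⟩ := hM.face i hi
      have hlab : T.label j = T.label i + M.step (u k) := by
        rw [hui]
        by_cases hs : M.IsStem (e (T.angle i))
        · rw [hjs hs, label_succ, step, step, if_pos hs, if_pos (hM.isStem _ hs)]
        · have := (hjn hs).label_eq
          rw [step, if_neg hs]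
          omega
      rcases hjO with rfl | hjO
      · refine ⟨0, hM.zero_mem, m + 1, ?_, ?_, ?_⟩
        · rw [husucc, hui, hf, angle_card h, angle_zero]
        · rw [hwsucc, hwi]
          have : T.label 0 = 3 := rfl
          push_cast
          omega
        · rw [mul_add]
          omega
      · refine ⟨j, hjO, m, ?_, ?_, by omega⟩
        · rw [husucc, hui, hf]
        · rw [hwsucc, hwi]
          omega
  obtain ⟨i, hi, m, -, hwk, hk⟩ := hpos (Nat.card D * (Nat.card D + 1))
  have h0 := (hnonneg (Nat.card D * (Nat.card D + 1))).1
  have hilt := hM.lt_card i hi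
  have hi₀lt := hM.lt_card i₀ hi₀
  have h1 := abs_le.1 (T.abs_label_sub_le i)
  have h2 := abs_le.1 (T.abs_label_sub_le i₀)
  have h3 : Nat.card D ≤ m := by
    by_contra h4
    have h5 : Nat.card D * (m + 1) ≤ Nat.card D * Nat.card D := Nat.mul_le_mul_left _ (by omega)
    rw [mul_add] at h5 hk
    omega
  omega

theorem exists_isCompleteClosure.{u, v} {V : Type u} {D : Type v} [Finite D] {T : StemMap V D}
    (h : T.IsUnicellular) (hl : T.label (Nat.card D) = 0) (hsafe : T.IsSafe) :
    ∃ (D' : Type v) (G : StemMap V D'), T.IsCompleteClosure G := by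
  suffices key : ∀ n : ℕ, ∀ (D' : Type v) (M : StemMap V D'), T.ClosesTo M →
      {x | M.IsStem x}.ncard = n → ∃ (D' : Type v) (G : StemMap V D'), T.IsCompleteClosure G from
    key _ D T ClosesTo.refl rfl
  intro n
  induction n with
  | zero =>
    intro D' M hM hn
    have := hM.finite
    rw [Set.ncard_eq_zero] at hn
    exact ⟨D', M, hM, fun d hd => by
      have : d ∈ {x | M.IsStem x} := hd
      rw [hn] at this
      exact this⟩
  | succ n ih =>
    intro D' M hM hn
    have hfin := hM.finite
    obtain ⟨s₀, hs₀⟩ : {x | M.IsStem x}.Nonempty := by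
      rw [← Set.ncard_pos]
      omega
    obtain ⟨e, O, hP⟩ := hM.exists_isPartialClosure h hsafe
    obtain ⟨s, hs⟩ := hP.exists_admissible h hl hs₀
    refine ih _ _ (hM.close s hs) ?_
    have h1 : {x | (M.closeTriple s hs).IsStem x} = some '' ({x | M.IsStem x} \ {s}) := by
      ext x
      cases x with
      | none => simpa using! M.attach_not_isStem_none _ _ _
      | some x =>
        have := M.attach_isStem_some s (M.face (M.face (M.face s))) hs.isStem (x := x)
        simp only [Set.mem_ofPred_eq, Set.mem_image, Set.mem_sdiff, Set.mem_singleton_iff,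
          Option.some.injEq, exists_eq_right]
        rw [and_comm]
        exact this
    rw [h1, Set.ncard_image_of_injective _ (Option.some_injective _),
      Set.ncard_sdiff_singleton_of_mem (s := {x | M.IsStem x}) hs.isStem, hn]
    rfl

/-- In a complete closure, the labels before the last one are positive. -/
theorem IsPartialClosure.label_pos [Finite D] {D' : Type*} {T : StemMap V D}
    (hl : T.label (Nat.card D) = 0) {G : StemMap V D'} {e : D → D'} {O : Set ℕ}
    (hG : T.IsPartialClosure G e O) (hns : ∀ d, ¬ G.IsStem d) {k : ℕ} (hk : k < Nat.card D) :
    0 < T.label k := by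
  suffices key : ∀ n, ∀ i ∈ O, Nat.card D - i = n → ∀ k, i ≤ k → k < Nat.card D →
      0 < T.label k from key _ 0 hG.zero_mem rfl k (Nat.zero_le k) hk
  intro n
  induction n using Nat.strong_induction_on with
  | _ n ih =>
    intro i hi hn k hik hk
    obtain ⟨j, hij, hjO, -, -, hjs⟩ := hG.face i hi
    have hs := hjs (hns _)
    have h1 := hs.label_eq
    rcases hjO with rfl | hjO
    · rcases eq_or_lt_of_le hik with rfl | h2
      · omega
      · have := hs.le_label k h2 hk
        omega
    · have hjlt := hG.lt_card j hjO
      have h3 := ih (Nat.card D - j) (by omega) j hjO rfl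
      have h4 := h3 j le_rfl hjlt
      rcases Nat.lt_or_ge k j with h2 | h2
      · rcases eq_or_lt_of_le hik with rfl | h5
        · omega
        · have := hs.le_label k h5 h2
          omega
      · exact h3 k h2 hk

/-! ### Verification of the hypotheses -/

theorem stemCount_eq [Fintype D] (T : StemMap V D) (v : V) :
    (T.stemCount v : ℤ) = ∑ x ∈ T.dartsAt v, T.stemInd x := by
  classical
  unfold stemInd
  rw [Finset.sum_boole, stemCount, Set.ncard_eq_toFinset_card']
  congr 2
  ext x
  simp [mem_dartsAt, and_comm]

theorem sum_stemInd [Fintype D] (T : StemMap V D) :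
    ∑ x, T.stemInd x = ({d | T.IsStem d}.ncard : ℤ) := by
  classical
  unfold stemInd
  rw [Finset.sum_boole, Set.ncard_eq_toFinset_card']
  congr 2
  ext x
  simp

theorem sum_one_sub_stemInd [Fintype D] (T : StemMap V D) :
    ∑ x, (1 - T.stemInd x) = ({d | ¬ T.IsStem d}.ncard : ℤ) := by
  classical
  have h : ∀ x, 1 - T.stemInd x = if ¬ T.IsStem x then 1 else 0 := by
    intro x
    unfold stemInd
    by_cases hx : T.IsStem x <;> simp [hx]
  simp_rw [h]
  rw [Finset.sum_boole, Set.ncard_eq_toFinset_card']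
  congr 2
  ext x
  simp

/-- The prescribed numbers of stems make up for the excess of the vertices: a vertex of excess `x`
has `x + 1` outgoing edges and `2 - x` stems, with the correction at the root cancelling. -/
theorem hasOutdegreeThree_of_isRootedUnicellular [Fintype V] [Fintype D] {T : StemMap V D} {n : ℕ}
    (hT : T.IsRootedUnicellular n) (hE : T.HasTorusEdges) : T.HasOutdegreeThree := by
  classical
  intro v
  have h : T.IsUnicellular := hT.unicellular
  have hspec := isSpecial_iff h hE
  obtain ⟨x₁, x₂, hx⟩ := exists_excess_eq h hE
  have hstem : (T.stemCount v : ℤ) = 2 - T.excess v + if v = T.rootVertex then 1 else 0 := by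
    by_cases hv : T.IsSpecial v
    · by_cases h12 : x₁ = x₂
      · have hset : {v | T.IsSpecial v} = {x₁} := by
          ext w
          rw [Set.mem_ofPred_eq, hspec, hx, ← h12, Set.mem_singleton_iff]
          by_cases hw : x₁ = w <;> simp [hw, eq_comm]
        have hv1 : x₁ = v := by
          have : v ∈ {v | T.IsSpecial v} := hv
          rw [hset] at this
          exact this.symm
        have := hT.stemCount_square (by rw [hset, Set.ncard_singleton]) v hv
        rw [this, hx, ← h12, if_pos hv1]
        split_ifs <;> simp
      · have hset : {v | T.IsSpecial v} = {x₁, x₂} := by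
          ext w
          rw [Set.mem_ofPred_eq, hspec, hx, Set.mem_insert_iff, Set.mem_singleton_iff]
          by_cases hw : x₁ = w <;> by_cases hw' : x₂ = w <;> simp [hw, hw', eq_comm]
        have hv1 : T.excess v = 1 := by
          have : v ∈ {v | T.IsSpecial v} := hv
          rw [hset] at this
          rw [hx]
          rcases this with rfl | rfl
          · rw [if_pos rfl, if_neg (Ne.symm h12)]
            rfl
          · rw [if_neg h12, if_pos rfl]
            rfl
        have := hT.stemCount_hexagonal (by rw [hset, Set.ncard_pair h12]) v hv
        rw [this, hv1]
        split_ifs <;> simp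
    · have h0 : T.excess v = 0 :=
        le_antisymm (not_lt.1 fun h1 => hv ((hspec v).2 h1)) (excess_nonneg h v)
      rw [hT.stemCount_normal v hv, h0]
      split_ifs <;> simp
  rw [stemCount_eq] at hstem
  rw [Finset.sum_add_distrib, hstem, excess]
  ring

theorem isBalancedTorus_of_isRootedSafeBalanced [Fintype V] [Fintype D] {T : StemMap V D} {n : ℕ}
    (hT : T.IsRootedSafeBalanced n) : T.IsBalancedTorus := by
  have h : T.IsUnicellular := hT.unicellular.unicellular
  have h1 := T.sum_stemInd
  have h2 := T.sum_one_sub_stemInd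
  have h3 := hT.unicellular.card_edge
  have h4 := hT.unicellular.card_stem
  have hV := hT.unicellular.card_vertex
  rw [Nat.card_eq_fintype_card] at hV
  have hE : T.HasTorusEdges := by
    rw [HasTorusEdges, h2, h3, hV]
    push_cast
    ring
  refine ⟨h, hE, ?_, hasOutdegreeThree_of_isRootedUnicellular hT.unicellular hE, hT.balanced⟩
  have h5 : ∑ x, T.step x = ∑ x, T.stemInd x - ∑ x, (1 - T.stemInd x) := by
    rw [← Finset.sum_sub_distrib]
    exact Finset.sum_congr rfl fun x _ => by rw [step_eq]; ring
  rw [label_eq_sum h, h5, h1, h2, h3]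
  push_cast
  omega

/-! ### Labels and distances -/

theorem finite_anglesAt (T : StemMap V D) (v : V) : (T.anglesAt v).Finite :=
  (Set.finite_Iic (Nat.card D)).subset fun _ hi => hi.1

theorem idx_mem_anglesAt [Finite D] {T : StemMap V D} (h : T.IsUnicellular) (x : D) :
    T.idx x ∈ T.anglesAt (T.vert x) := ⟨(idx_lt h x).le, by rw [angle_idx h]⟩

theorem anglesAt_nonempty [Finite D] {T : StemMap V D} (h : T.IsUnicellular) (v : V) :
    (T.anglesAt v).Nonempty := by
  obtain ⟨x, rfl⟩ := T.vert_surjective v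
  exact ⟨_, idx_mem_anglesAt h x⟩

theorem minLabel_le (T : StemMap V D) {v : V} {i : ℕ} (hi : i ∈ T.anglesAt v) :
    T.minLabel v ≤ T.label i :=
  csInf_le ((T.finite_anglesAt v).image _).bddBelow ⟨i, hi, rfl⟩

theorem exists_minLabel_eq [Finite D] {T : StemMap V D} (h : T.IsUnicellular) (v : V) :
    ∃ i ∈ T.anglesAt v, T.label i = T.minLabel v :=
  Int.csInf_mem ((anglesAt_nonempty h v).image _) ((T.finite_anglesAt v).image _).bddBelow

theorem first_mem [Finite D] {T : StemMap V D} (h : T.IsUnicellular) (v : V) :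
    T.first v ∈ T.anglesAt v := Nat.sInf_mem (anglesAt_nonempty h v)

theorem first_lt [Finite D] {T : StemMap V D} (h : T.IsUnicellular) (v : V) :
    T.first v < Nat.card D := by
  obtain ⟨x, rfl⟩ := T.vert_surjective v
  exact (Nat.sInf_le (idx_mem_anglesAt h x)).trans_lt (idx_lt h x)

/-- The shape of the graph of a complete closure of `T`: up to loops, its edges join the angles of
`T` to their successors, and all labels but the last one are positive. -/
structure IsSuccGraph [Finite D] (T : StemMap V D) (G : SimpleGraph V) : Prop where
  label_pos : ∀ i < Nat.card D, 0 < T.label i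
  exists_succ : ∀ i < Nat.card D, ∃ j, T.IsSucc i j ∧
    (T.vert (T.angle i) = T.vert (T.angle j) ∨ G.Adj (T.vert (T.angle i)) (T.vert (T.angle j)))
  succ_of_adj : ∀ u w, G.Adj u w → ∃ i j, T.IsSucc i j ∧
    ((u = T.vert (T.angle i) ∧ w = T.vert (T.angle j)) ∨
      (w = T.vert (T.angle i) ∧ u = T.vert (T.angle j)))

theorem IsPartialClosure.isSuccGraph [Finite D] {D' : Type*} {T : StemMap V D}
    (h : T.IsUnicellular) (hl : T.label (Nat.card D) = 0) {G : StemMap V D'} {e : D → D'}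
    {O : Set ℕ} (hG : T.IsPartialClosure G e O) (hns : ∀ d, ¬ G.IsStem d) :
    T.IsSuccGraph G.graph where
  label_pos i hi := hG.label_pos hl hns hi
  exists_succ i hi := by
    obtain ⟨j, hj, hv⟩ := hG.edge i hi (hns _)
    refine ⟨j, hj, or_iff_not_imp_left.2 fun hne => ⟨hne, e (T.angle i), hns _, hG.vert _, hv⟩⟩
  succ_of_adj u w huw := by
    obtain ⟨-, d, -, rfl, rfl⟩ := huw
    obtain ⟨x, hx⟩ := hG.cover d
    obtain ⟨j, hj, hv⟩ := hG.edge (T.idx x) (idx_lt h x) (hns _)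
    refine ⟨T.idx x, j, hj, ?_⟩
    rw [angle_idx h] at hv ⊢
    rcases hx with rfl | rfl
    · exact Or.inl ⟨hG.vert _, hv⟩
    · rw [G.flip_flip]
      exact Or.inr ⟨hG.vert _, hv⟩

section SuccGraph

variable [Fintype D] {T : StemMap V D} {G : SimpleGraph V}

/-- Following successors leads from any angle to the next angle with a given smaller label, at a
distance at most the difference of the labels. -/
theorem IsSuccGraph.exists_walk (hG : T.IsSuccGraph G) (hl : T.label (Nat.card D) = 0) {i : ℕ}
    (hi : i ≤ Nat.card D) {a : ℤ} (ha : 0 ≤ a) (hai : a ≤ T.label i) :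
    ∃ j, i ≤ j ∧ j ≤ Nat.card D ∧ T.label j = a ∧ (∀ k, i ≤ k → k < j → a < T.label k) ∧
      ∃ p : G.Walk (T.vert (T.angle i)) (T.vert (T.angle j)), (p.length : ℤ) ≤ T.label i - a := by
  obtain ⟨n, hn⟩ : ∃ n : ℕ, T.label i = a + n := ⟨(T.label i - a).toNat, by omega⟩
  induction n generalizing i with
  | zero =>
    exact ⟨i, le_rfl, hi, by simpa using hn, fun k h1 h2 => by omega, SimpleGraph.Walk.nil,
      by simpa using hai⟩
  | succ n ih =>
    push_cast at hn
    have hilt : i < Nat.card D := by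
      refine lt_of_le_of_ne hi ?_
      rintro rfl
      omega
    obtain ⟨j₁, hj₁, hadj⟩ := hG.exists_succ i hilt
    have h1 := hj₁.label_eq
    obtain ⟨j, hj, hjc, hja, hjk, p, hp⟩ := ih hj₁.le_card (by omega) (by omega)
    have hlt := hj₁.lt
    refine ⟨j, by omega, hjc, hja, ?_, ?_⟩
    · intro k hk1 hk2
      rcases Nat.lt_or_ge k j₁ with h2 | h2
      · rcases eq_or_lt_of_le hk1 with rfl | h3
        · omega
        · have := hj₁.le_label k h3 h2
          omega
      · exact hjk k h2 hk2
    · rcases hadj with h2 | h2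
      · rw [h2]
        exact ⟨p, by omega⟩
      · refine ⟨SimpleGraph.Walk.cons h2 p, ?_⟩
        rw [SimpleGraph.Walk.length_cons]
        push_cast
        omega

variable [Fintype V]

theorem IsSuccGraph.exists_walk_root (hG : T.IsSuccGraph G) (hT : T.IsBalancedTorus) {i : ℕ}
    (hi : i ≤ Nat.card D) :
    ∃ p : G.Walk (T.vert (T.angle i)) T.rootVertex, (p.length : ℤ) ≤ T.label i := by
  have h0 : 0 ≤ T.label i := by
    rcases eq_or_lt_of_le hi with rfl | h1
    · exact hT.label_card.ge
    · exact (hG.label_pos i h1).le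
  obtain ⟨j, -, hj, hj0, -, p, hp⟩ := hG.exists_walk hT.label_card hi le_rfl h0
  have hjc : j = Nat.card D := by
    rcases eq_or_lt_of_le hj with h1 | h1
    · exact h1
    · have := hG.label_pos j h1
      omega
  subst hjc
  have hv : T.vert (T.angle (Nat.card D)) = T.rootVertex := by
    rw [angle_card hT.unicellular]; rfl
  exact ⟨p.copy rfl hv, by simpa using hp⟩

theorem IsSuccGraph.connected (hG : T.IsSuccGraph G) (hT : T.IsBalancedTorus) : G.Connected := by
  have h1 : ∀ v, G.Reachable v T.rootVertex := by
    intro v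
    have hi := first_mem hT.unicellular v
    obtain ⟨p, -⟩ := hG.exists_walk_root hT hi.1
    exact ⟨p.copy hi.2 rfl⟩
  have : Nonempty V := ⟨T.rootVertex⟩
  exact ⟨fun u v => (h1 u).trans (h1 v).symm⟩

/-- The labels of the angles of a vertex exceed their minimum by at most six. -/
theorem IsSuccGraph.label_le (hG : T.IsSuccGraph G) (hT : T.IsBalancedTorus) {v : V} {i : ℕ}
    (hi : i ∈ T.anglesAt v) : T.label i ≤ T.minLabel v + 6 := by
  have h := hT.unicellular
  have hl := hT.label_card
  obtain ⟨i', hi', hm⟩ := exists_minLabel_eq h v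
  rw [← hm]
  have hlab : ∀ j < Nat.card D, T.lab (T.angle j) = T.label j := by
    intro j hj
    rw [lab, idx_angle h hj]
  rcases eq_or_lt_of_le hi.1 with h1 | h1
  · rw [h1, hl]
    rcases eq_or_lt_of_le hi'.1 with h2 | h2
    · rw [h2, hl]
      norm_num
    · have := hG.label_pos i' h2
      omega
  · rcases eq_or_lt_of_le hi'.1 with h2 | h2
    · have h3 := hi'.2
      rw [h2, angle_card h] at h3
      have := lab_le_six hT (y := T.angle i) (hi.2.trans h3.symm)
      rw [hlab i h1] at this
      rw [h2, hl]
      omega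
    · have := lab_le_add_six hT (hi'.2.trans hi.2.symm)
      rwa [hlab i h1, hlab i' h2] at this

theorem IsSuccGraph.dist_root_le (hG : T.IsSuccGraph G) (hT : T.IsBalancedTorus) (v : V) :
    (G.dist T.rootVertex v : ℤ) ≤ T.minLabel v := by
  obtain ⟨i, hi, hm⟩ := exists_minLabel_eq hT.unicellular v
  obtain ⟨p, hp⟩ := hG.exists_walk_root hT hi.1
  have h1 := SimpleGraph.dist_le (p.copy hi.2 rfl)
  rw [SimpleGraph.Walk.length_copy] at h1
  rw [← hm, SimpleGraph.dist_comm]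
  exact le_trans (by exact_mod_cast h1) hp

/-- Adjacent vertices have angles whose labels differ by one, while the labels at one vertex differ
by at most six. -/
theorem IsSuccGraph.minLabel_le_of_adj (hG : T.IsSuccGraph G) (hT : T.IsBalancedTorus) {u w : V}
    (huw : G.Adj u w) : T.minLabel u ≤ T.minLabel w + 7 := by
  obtain ⟨i, j, hij, h1⟩ := hG.succ_of_adj u w huw
  have hi : i ∈ T.anglesAt (T.vert (T.angle i)) := ⟨(hij.lt.trans_le hij.le_card).le, rfl⟩
  have hj : j ∈ T.anglesAt (T.vert (T.angle j)) := ⟨hij.le_card, rfl⟩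
  have e1 := T.minLabel_le hi
  have e2 := T.minLabel_le hj
  have e3 := hG.label_le hT hi
  have e4 := hG.label_le hT hj
  have e5 := hij.label_eq
  rcases h1 with ⟨rfl, rfl⟩ | ⟨rfl, rfl⟩ <;> omega

theorem IsSuccGraph.minLabel_le_dist (hG : T.IsSuccGraph G) (hT : T.IsBalancedTorus) (v : V) :
    T.minLabel v ≤ 7 * G.dist T.rootVertex v := by
  have h1 : ∀ {u w : V} (p : G.Walk u w), T.minLabel u ≤ T.minLabel w + 7 * p.length := by
    intro u w p
    induction p with
    | nil => simp
    | cons huw p ih =>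
      have := hG.minLabel_le_of_adj hT huw
      rw [SimpleGraph.Walk.length_cons]
      push_cast
      omega
  obtain ⟨p, hp⟩ := (hG.connected hT).exists_walk_length_eq_dist v T.rootVertex
  have h2 := h1 p
  have h3 : T.minLabel T.rootVertex ≤ T.label (Nat.card D) :=
    T.minLabel_le ⟨le_rfl, by rw [angle_card hT.unicellular]; rfl⟩
  rw [hT.label_card] at h3
  rw [SimpleGraph.dist_comm, ← hp]
  omega

/-- From two angles, following successors leads to the same first angle that comes after both and
has a smaller label than all angles between them. -/
theorem IsSuccGraph.dist_le (hG : T.IsSuccGraph G) (hT : T.IsBalancedTorus) {i j : ℕ}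
    (hij : i ≤ j) (hj : j < Nat.card D) :
    (G.dist (T.vert (T.angle i)) (T.vert (T.angle j)) : ℤ) ≤
      T.label i + T.label j - 2 * sInf (T.label '' Set.Icc i j) + 2 := by
  set m := sInf (T.label '' Set.Icc i j) with hm
  have hfin : (T.label '' Set.Icc i j).Finite := (Set.finite_Icc i j).image _
  have hle : ∀ k, i ≤ k → k ≤ j → m ≤ T.label k := fun k h1 h2 =>
    csInf_le hfin.bddBelow ⟨k, ⟨h1, h2⟩, rfl⟩
  have hpos : 0 < m := by
    obtain ⟨k, hk, hkm⟩ := Int.csInf_mem (s := T.label '' Set.Icc i j)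
      ⟨_, i, ⟨le_rfl, hij⟩, rfl⟩ hfin.bddBelow
    rw [hm, ← hkm]
    exact hG.label_pos k (hk.2.trans_lt hj)
  have hmi := hle i le_rfl hij
  have hmj := hle j hij le_rfl
  obtain ⟨a, hia, -, hla, hka, p, hp⟩ := hG.exists_walk hT.label_card (i := i) (by omega)
    (a := m - 1) (by omega) (by omega)
  obtain ⟨b, hjb, -, hlb, hkb, q, hq⟩ := hG.exists_walk hT.label_card (i := j) hj.le
    (a := m - 1) (by omega) (by omega)
  have hja : j < a := by
    by_contra hc
    have := hle a hia (by omega)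
    omega
  have hab : a = b := by
    rcases lt_trichotomy a b with h1 | h1 | h1
    · have := hkb a hja.le h1
      omega
    · exact h1
    · have := hka b (by omega) h1
      omega
  subst hab
  have h1 : (G.dist (T.vert (T.angle i)) (T.vert (T.angle j)) : ℤ) ≤ p.length + q.length := by
    have := SimpleGraph.dist_le (p.append q.reverse)
    rw [SimpleGraph.Walk.length_append, SimpleGraph.Walk.length_reverse] at this
    exact_mod_cast this
  omega

/-- The estimate `dist_le` applied to the first angles of two vertices, whose labels exceed the
minima by at most six. -/
theorem IsSuccGraph.dist_le_minBetween (hG : T.IsSuccGraph G) (hT : T.IsBalancedTorus) (u v : V) :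
    (G.dist u v : ℤ) ≤ T.minLabel u + T.minLabel v - 2 * T.minBetween u v + 14 := by
  have h := hT.unicellular
  have hu := first_mem h u
  have hv := first_mem h v
  have e1 := hG.label_le hT hu
  have e2 := hG.label_le hT hv
  unfold minBetween
  split_ifs with hle
  · have h1 := hG.dist_le hT hle (first_lt h v)
    rw [hu.2, hv.2] at h1
    omega
  · have h1 := hG.dist_le hT (not_le.1 hle).le (first_lt h u)
    rw [hu.2, hv.2, SimpleGraph.dist_comm] at h1
    omega

end SuccGraph

end StemMap

end

theorem mainTheorem7 {V D : Type*} [Finite V] [Finite D] (n : ℕ) (hn : 1 ≤ n)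
    (T : StemMap V D) (hT : T.IsRootedSafeBalanced n) :
    (∃ (D' : Type _) (G : StemMap V D'), T.IsCompleteClosure G) ∧
    ∀ (D' : Type _) (G : StemMap V D'), T.IsCompleteClosure G →
      G.graph.Connected ∧
      (∀ v, (T.minLabel v : ℝ) / 7 ≤ G.graph.dist T.rootVertex v ∧
        (G.graph.dist T.rootVertex v : ℤ) ≤ T.minLabel v) ∧
      ∀ u v, (G.graph.dist u v : ℤ) ≤
        T.minLabel u + T.minLabel v - 2 * T.minBetween u v + 14 := by
  have := Fintype.ofFinite V
  have := Fintype.ofFinite D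
  have hB := StemMap.isBalancedTorus_of_isRootedSafeBalanced hT
  refine ⟨StemMap.exists_isCompleteClosure hB.unicellular hB.label_card hT.safe,
    fun D' G hG => ?_⟩
  obtain ⟨e, O, hP⟩ := hG.1.exists_isPartialClosure hB.unicellular hT.safe
  have hS := hP.isSuccGraph hB.unicellular hB.label_card hG.2
  refine ⟨hS.connected hB, fun v => ⟨?_, hS.dist_root_le hB v⟩, hS.dist_le_minBetween hB⟩
  have h : (T.minLabel v : ℝ) ≤ 7 * G.graph.dist T.rootVertex v := by
    exact_mod_cast hS.minLabel_le_dist hB v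
  linarith
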